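/- Let $M$ be a smooth Riemannian manifold (Hausdorff, second countable, without boundary, of finite dimension, not necessarily connected or complete), let $A$ be a (trivially graded, not necessarily unital) $C^*$-algebra, $\mathcal{A}\subset A$ a $*$-subalgebra, and $\mathcal{H}$ a complex Hilbert space. An odd unbounded Kasparov $A$-$B$-module $(\mathcal{A},{}_\pi E_B,\mathcal{D})$ consists of a countably generated Hilbert $B$-module $E$, a $*$-homomorphism $\pi\colon A\to\mathrm{End}_B(E)$ into the adjointable operators, a separable dense $*$-subalgebra $\mathcal{A}\subset A$, and a self-adjoint regular operator $\mathcal{D}$ on $E$ such that, for every $a\in\mathcal{A}$, $\pi(a)$ preserves $\operatorname{Dom}\mathcal{D}$ and $[\mathcal{D},\pi(a)]$ extends to an element of $\mathrm{End}_B(E)$, and such that for every $a\in A$ the map $\pi(a)\circ\iota\colon\operatorname{Dom}\mathcal{D}\to E$ is compact, where $\iota$ is the inclusion and $\operatorname{Dom}\mathcal{D}$ carries the graph inner product $(\phi|\psi)+(\mathcal{D}\phi|\mathcal{D}\psi)$. An odd spectral triple is the case $B=\mathbb{C}$. A map $S\colon M\to\mathcal{L}(\mathcal{H}_1,\mathcal{H}_2)$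 has a uniformly bounded weak derivative if $x\mapsto\langle S(x)\xi,\eta\rangle$ is differentiable for all $\xi\in\mathcal{H}_1$, $\eta\in\mathcal{H}_2$, its derivative is given by a bounded operator $dS(x)\colon\mathcal{H}_1\to\mathcal{H}_2\otimes T_x^*M$ for every $x$, and $\sup_{x\in M}\|dS(x)\|<\infty$. Let $\{(\mathcal{A},{}_{\pi_x}\mathcal{H},\mathcal{D}_1(x))\}_{x\in M}$ be a weakly differentiable family of odd spectral triples; that is, each $(\mathcal{A},{}_{\pi_x}\mathcal{H},\mathcal{D}_1(x))$ is an odd spectral triple, and there is a Hilbert space $W$, continuously and densely embedded in $\mathcal{H}$ by $\iota_W\colon W\hookrightarrow\mathcal{H}$, such that 1. $\pi_x(a)\circ\iota_W$ is compact for all $x\in M$ and $a\in\mathcal{A}$; 2. $\operatorname{Dom}\mathcal{D}_1(x)=W$ for all $x\in M$, and there are constants $C_1,C_2>0$ with $C_1\|\xi\|_W\le\|\xi\|_{\mathcal{D}_1(x)}\le C_2\|\xi\|_W$ for all $\xi\in W$ and $x\in M$, where $\|\cdot\|_{\mathcal{D}_1(x)}$ is the graph norm; 3. for each $a\in\mathcal{A}$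 the maps $\mathcal{D}_1(\cdot)\colon M\to\mathcal{L}(W,\mathcal{H})$ and $\pi_\cdot(a)\colon M\to\mathcal{L}(\mathcal{H})$ have uniformly bounded weak derivatives, and $[\mathcal{D}_1(\cdot),\pi_\cdot(a)]\colon M\to\mathcal{L}(\mathcal{H})$ is norm continuous. Then the formulas $(\pi(a)\psi)(x):=\pi_x(a(x))\psi(x)$, for $a\in C_0(M,A)$ and $\psi\in C_0(M,\mathcal{H})$, and $(\mathcal{D}_1(\cdot)\psi)(x):=\mathcal{D}_1(x)\psi(x)$, for $\psi\in\operatorname{Dom}\mathcal{D}_1(\cdot):=C_0(M,W)$, give a well-defined representation $\pi$ of $C_0(M,A)$ and a well-defined operator $\mathcal{D}_1(\cdot)$ on the Hilbert $C_0(M)$-module $C_0(M,\mathcal{H})$, and $$\big(\mathcal{A}\odot C_c^\infty(M),\ C_0(M,\mathcal{H})_{C_0(M)},\ \mathcal{D}_1(\cdot)\big)$$ is an odd unbounded Kasparov $C_0(M,A)$-$C_0(M)$-module, where $\mathcal{A}\odot C_c^\infty(M)\subset C_0(M,A)$ is the linear span of the functions $x\mapsto f(x)a$ with $a\in\mathcal{A}$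 and $f\in C_c^\infty(M)$. -/

import Mathlib

open scoped ZeroAtInfty ComplexOrder Manifold ContDiff Bundle

noncomputable section

/-! ### The Hilbert `C₀(M)`-module `C₀(M, H)` -/

namespace C0Module

section Order

variable {M : Type*} [TopologicalSpace M]

/-- The pointwise order on `C₀(M) = C₀(M, ℂ)`, which is its order as a C⋆-algebra. -/
instance instPartialOrder : PartialOrder C₀(M, ℂ) where
  le f g := ∀ x, f x ≤ g x
  le_refl _ _ := le_rfl
  le_trans _ _ _ h h' x := (h x).trans (h' x)
  le_antisymm _ _ h h' := ZeroAtInftyContinuousMap.ext fun x => le_antisymm (h x) (h' x)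

theorem le_def (f g : C₀(M, ℂ)) : f ≤ g ↔ ∀ x, f x ≤ g x := Iff.rfl

instance instStarOrderedRing : StarOrderedRing C₀(M, ℂ) := by
  refine StarOrderedRing.of_le_iff fun f g => ⟨fun h => ?_, ?_⟩
  · have hc : Continuous fun x => ((Real.sqrt (g x - f x).re : ℝ) : ℂ) := by fun_prop
    have hz : Filter.Tendsto (fun x => ((Real.sqrt (g x - f x).re : ℝ) : ℂ))
        (Filter.cocompact M) (nhds 0) := by
      have h1 : Filter.Tendsto (fun x => (g - f) x) (Filter.cocompact M) (nhds 0) :=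
        zero_at_infty (g - f)
      have h2 : Continuous fun z : ℂ => ((Real.sqrt z.re : ℝ) : ℂ) := by fun_prop
      have h3 := (h2.tendsto 0).comp h1
      simpa [Function.comp_def] using h3
    refine ⟨⟨⟨_, hc⟩, hz⟩, ZeroAtInftyContinuousMap.ext fun x => ?_⟩
    have hx := (Complex.nonneg_iff.mp (sub_nonneg.mpr (h x)))
    have key : g x - f x = (((g x - f x).re : ℝ) : ℂ) :=
      Complex.ext (by simp) (by simpa using hx.2.symm)
    have hs : ((Real.sqrt (g x - f x).re : ℝ) : ℂ) * ((Real.sqrt (g x - f x).re : ℝ) : ℂ)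
        = g x - f x := by
      rw [← Complex.ofReal_mul, Real.mul_self_sqrt hx.1, ← key]
    change g x = f x + star ((Real.sqrt (g x - f x).re : ℝ) : ℂ)
      * ((Real.sqrt (g x - f x).re : ℝ) : ℂ)
    rw [Complex.star_def, Complex.conj_ofReal, hs]
    ring
  · rintro ⟨s, rfl⟩ x
    have : 0 ≤ star (s x) * s x := star_mul_self_nonneg _
    simpa using this

end Order

variable {M : Type*} [TopologicalSpace M] {H : Type*} [NormedAddCommGroup H]
  [InnerProductSpace ℂ H]

/-- The (right) action of `C₀(M)` on `C₀(M, H)`; the algebra is commutative, so the side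
on which it is written is immaterial. -/
instance instSMul : SMul C₀(M, ℂ) C₀(M, H) where
  smul f ψ :=
    { toFun := fun x => f x • ψ x
      continuous_toFun := by fun_prop
      zero_at_infty' := by
        have := (zero_at_infty f).smul (zero_at_infty ψ)
        simpa using this }

@[simp] theorem smul_apply (f : C₀(M, ℂ)) (ψ : C₀(M, H)) (x : M) :
    (f • ψ) x = f x • ψ x := rfl

/-- The `C₀(M)`-valued inner product `x ↦ ⟪φ x, ψ x⟫` on `C₀(M, H)`. -/
def innerC0 (φ ψ : C₀(M, H)) : C₀(M, ℂ) where
  toFun := fun x => inner ℂ (φ x) (ψ x)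
  continuous_toFun := by fun_prop
  zero_at_infty' := by
    have := (zero_at_infty φ).inner (𝕜 := ℂ) (zero_at_infty ψ)
    simpa using this

theorem innerC0_apply (φ ψ : C₀(M, H)) (x : M) : innerC0 φ ψ x = inner ℂ (φ x) (ψ x) := rfl

theorem norm_le_iff {V : Type*} [NormedAddCommGroup V] (f : C₀(M, V)) {C : ℝ} (hC : 0 ≤ C) :
    ‖f‖ ≤ C ↔ ∀ x, ‖f x‖ ≤ C := by
  rw [← ZeroAtInftyContinuousMap.norm_toBCF_eq_norm]
  exact BoundedContinuousFunction.norm_le hC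

/-- `C₀(M, H)`, with its supremum norm, is a Hilbert C⋆-module over `C₀(M)`. -/
instance instCStarModule : CStarModule C₀(M, ℂ) C₀(M, H) where
  inner := innerC0
  inner_add_right := ZeroAtInftyContinuousMap.ext fun x => by
    simp [innerC0_apply]
  inner_self_nonneg {φ} := fun x => by
    simp only [innerC0_apply, ZeroAtInftyContinuousMap.zero_apply]
    rw [inner_self_eq_norm_sq_to_K]
    exact pow_nonneg (Complex.zero_le_real.mpr (norm_nonneg (φ x))) 2
  inner_self {φ} := by
    constructor
    · intro h
      ext x
      have := DFunLike.congr_fun h x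
      simpa [innerC0_apply] using this
    · rintro rfl
      ext x
      simp [innerC0_apply]
  inner_op_smul_right := ZeroAtInftyContinuousMap.ext fun x => by
    simp [innerC0_apply]
  inner_smul_right_complex := ZeroAtInftyContinuousMap.ext fun x => by
    simp [innerC0_apply]
  star_inner φ ψ := ZeroAtInftyContinuousMap.ext fun x => by
    simp [innerC0_apply]
  norm_eq_sqrt_norm_inner_self φ := by
    have hx : ∀ x, ‖innerC0 φ φ x‖ = ‖φ x‖ ^ 2 := fun x => by
      rw [innerC0_apply, inner_self_eq_norm_sq_to_K]; simp
    apply le_antisymm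
    · rw [norm_le_iff _ (Real.sqrt_nonneg _)]
      intro x
      apply Real.le_sqrt_of_sq_le
      rw [← hx]
      exact (norm_le_iff _ (norm_nonneg _)).mp le_rfl x
    · rw [Real.sqrt_le_left (norm_nonneg _), norm_le_iff _ (by positivity)]
      intro x
      rw [hx]
      have := (norm_le_iff φ (norm_nonneg _)).mp le_rfl x
      gcongr

end C0Module

/-! ### Unbounded operators on Hilbert modules and odd unbounded Kasparov modules -/

section Kasparov

/- In a Hilbert module over a *commutative* C⋆-algebra left and right actions are the same thing,
so that `CStarModule B E` is the notion of a right Hilbert `B`-module. -/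
variable (B : Type*) {E : Type*} [NonUnitalCommCStarAlgebra B] [PartialOrder B]
  [StarOrderedRing B] [NormedAddCommGroup E] [NormedSpace ℂ E] [SMul B E] [CStarModule B E]

/-- `E` is countably generated: for some countable `s`, the linear span of the elements
`e · b` with `e ∈ s` and `b ∈ B` is dense in `E`. -/
def IsCountablyGeneratedModule (E : Type*) [NormedAddCommGroup E] [NormedSpace ℂ E]
    [SMul B E] : Prop :=
  ∃ s : Set E, s.Countable ∧
    Dense (Submodule.span ℂ {y : E | ∃ b : B, ∃ e ∈ s, y = b • e} : Set E)

/-- `T` is adjointable, i.e. belongs to `End_B(E)`. -/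
def IsAdjointableEnd (T : E →L[ℂ] E) : Prop :=
  ∃ T' : E →L[ℂ] E, ∀ φ ψ : E, inner B (T φ) ψ = inner B φ (T' ψ)

/-- The graph of the adjoint of an operator `D` (single valued if `D` is densely defined). -/
def adjointGraph (D : E →ₗ.[ℂ] E) : Set (E × E) :=
  {p | ∀ ψ : D.domain, inner B (D ψ) p.1 = inner B (ψ : E) p.2}

/-- `D` is `B`-linear: its domain is a `B`-submodule, on which `D` commutes with the action. -/
def IsModuleLinear (D : E →ₗ.[ℂ] E) : Prop :=
  ∀ (b : B) (ψ : D.domain), ∃ h : b • (ψ : E) ∈ D.domain, D ⟨b • (ψ : E), h⟩ = b • D ψ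

/-- `D` is self-adjoint: it is densely defined and `D = D⋆`. -/
def IsSelfAdjointOp (D : E →ₗ.[ℂ] E) : Prop :=
  Dense (D.domain : Set E) ∧ (D.graph : Set (E × E)) = adjointGraph B D

/-- `D` is a (closed) regular operator: it is closed and densely defined, its adjoint is densely
defined, and `1 + D⋆D` has dense range. -/
def IsRegularOp (D : E →ₗ.[ℂ] E) : Prop :=
  IsClosed (D.graph : Set (E × E)) ∧ Dense (D.domain : Set E) ∧
  Dense {η : E | ∃ ζ : E, (η, ζ) ∈ adjointGraph B D} ∧
  Dense {η : E | ∃ (ψ : D.domain) (ζ : E), (D ψ, ζ) ∈ adjointGraph B D ∧ η = ψ + ζ}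

/-- The graph inner product `(φ|ψ)_D = (φ|ψ) + (Dφ|Dψ)` on `Dom D`. -/
def graphInner (D : E →ₗ.[ℂ] E) (φ ψ : D.domain) : B :=
  inner B (φ : E) (ψ : E) + inner B (D φ) (D ψ)

/-- The graph norm `‖ψ‖_D = ‖(ψ|ψ)_D‖^{1/2}` on `Dom D`. -/
def graphNorm (D : E →ₗ.[ℂ] E) (ψ : D.domain) : ℝ := Real.sqrt ‖graphInner B D ψ ψ‖

/-- For `T : E → E`, the map `T ∘ ι`, where `ι : Dom D → E` is the inclusion and `Dom D` is the
Hilbert module with the graph inner product, is compact: it is a limit in operator norm of finite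
rank operators `ψ ↦ ∑ i, x i · (y i|ψ)_D`. -/
def IsCompactFromDomain (D : E →ₗ.[ℂ] E) (T : E →L[ℂ] E) : Prop :=
  ∀ ε : ℝ, 0 < ε → ∃ (n : ℕ) (x : Fin n → E) (y : Fin n → D.domain), ∀ ψ : D.domain,
    ‖T ψ - ∑ i, graphInner B D (y i) ψ • x i‖ ≤ ε * graphNorm B D ψ

/-- `(𝒜, E_B, D)`, with left action `ρ` of `A`, is an odd unbounded Kasparov `A`-`B`-module. -/
structure IsOddUnboundedKasparovModule [CompleteSpace E] {A : Type*} [NonUnitalCStarAlgebra A]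
    (𝒜 : NonUnitalStarSubalgebra ℂ A) (ρ : A →ₙₐ[ℂ] (E →L[ℂ] E)) (D : E →ₗ.[ℂ] E) : Prop where
  countablyGenerated : IsCountablyGeneratedModule B E
  /-- `ρ` is a `*`-homomorphism into the adjointable operators. -/
  star_hom : ∀ (a : A) (φ ψ : E), inner B (ρ a φ) ψ = inner B φ (ρ (star a) ψ)
  separable : TopologicalSpace.IsSeparable (𝒜 : Set A)
  dense : Dense (𝒜 : Set A)
  moduleLinear : IsModuleLinear B D
  selfAdjoint : IsSelfAdjointOp B D
  regular : IsRegularOp B D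
  /-- `ρ(𝒜)` preserves `Dom D`. -/
  map_domain : ∀ a ∈ 𝒜, ∀ ψ ∈ D.domain, ρ a ψ ∈ D.domain
  /-- For `a ∈ 𝒜`, the commutator `[D, ρ a]` extends to a bounded operator in `End_B(E)`. -/
  bounded_commutator : ∀ (a : A) (ha : a ∈ 𝒜), ∃ T : E →L[ℂ] E, IsAdjointableEnd B T ∧
    ∀ ψ : D.domain, T ψ = D ⟨ρ a ψ, map_domain a ha ψ ψ.2⟩ - ρ a (D ψ)
  /-- `ρ a ∘ ι : Dom D → E` is compact for every `a ∈ A`. -/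
  locally_compact : ∀ a : A, IsCompactFromDomain B D (ρ a)

/-- An odd spectral triple `(𝒜, H, D)` is an odd unbounded Kasparov `A`-`ℂ`-module. -/
abbrev IsOddSpectralTriple {H : Type*} [NormedAddCommGroup H] [InnerProductSpace ℂ H]
    [CompleteSpace H] {A : Type*} [NonUnitalCStarAlgebra A]
    (𝒜 : NonUnitalStarSubalgebra ℂ A) (ρ : A →ₙₐ[ℂ] (H →L[ℂ] H)) (D : H →ₗ.[ℂ] H) : Prop :=
  IsOddUnboundedKasparovModule ℂ 𝒜 ρ D

end Kasparov

/-! ### Weakly differentiable families of spectral triples -/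

section Families

/-- `S : M → 𝓛(H₁, H₂)` has a uniformly bounded weak derivative: all functions
`x ↦ ⟪η, S x ξ⟫` are differentiable, their derivatives are given by bounded operators
`dS x v : H₁ → H₂`, linear in the tangent vector `v` (that is, by an operator
`dS x : H₁ → H₂ ⊗ T_x^*M`), and these are bounded uniformly with respect to the Riemannian norm. -/
def HasUniformlyBoundedWeakDeriv (m : ℕ) {M : Type*} [TopologicalSpace M]
    [ChartedSpace (EuclideanSpace ℝ (Fin m)) M]
    [Bundle.RiemannianBundle (fun x : M => TangentSpace (𝓡 m) x)]
    {H₁ H₂ : Type*} [NormedAddCommGroup H₁] [InnerProductSpace ℂ H₁]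
    [NormedAddCommGroup H₂] [InnerProductSpace ℂ H₂] (S : M → H₁ →L[ℂ] H₂) : Prop :=
  (∀ ξ η, MDifferentiable (𝓡 m) 𝓘(ℝ, ℂ) fun x => inner ℂ η (S x ξ)) ∧
  ∃ dS : ∀ x : M, TangentSpace (𝓡 m) x →ₗ[ℝ] (H₁ →L[ℂ] H₂),
    (∀ x v ξ η, mfderiv (𝓡 m) 𝓘(ℝ, ℂ) (fun y => (inner ℂ η (S y ξ) : ℂ)) x v
      = (inner ℂ η (dS x v ξ) : ℂ)) ∧
    ∃ C : ℝ, ∀ x v, ‖dS x v‖ ≤ C * ‖v‖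

/-- `{(𝒜, _{ρ x}H, D x)}_{x ∈ M}` is a weakly differentiable family of (odd) spectral triples,
where `ι : W → H` is the embedding of the common domain `W`. -/
structure IsWeaklyDifferentiableFamily (m : ℕ) {M : Type*} [TopologicalSpace M]
    [ChartedSpace (EuclideanSpace ℝ (Fin m)) M]
    [Bundle.RiemannianBundle (fun x : M => TangentSpace (𝓡 m) x)]
    {A : Type*} [NonUnitalCStarAlgebra A]
    {H : Type*} [NormedAddCommGroup H] [InnerProductSpace ℂ H] [CompleteSpace H]
    {W : Type*} [NormedAddCommGroup W] [InnerProductSpace ℂ W]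
    (𝒜 : NonUnitalStarSubalgebra ℂ A) (ρ : M → A →ₙₐ[ℂ] (H →L[ℂ] H)) (D : M → H →ₗ.[ℂ] H)
    (ι : W →L[ℂ] H) : Prop where
  spectralTriple : ∀ x, IsOddSpectralTriple 𝒜 (ρ x) (D x)
  /-- `W` is continuously and densely embedded in `H`. -/
  embedding_injective : Function.Injective ι
  embedding_denseRange : DenseRange ι
  /-- The embedding is locally compact. -/
  embedding_locallyCompact : ∀ x, ∀ a ∈ 𝒜, IsCompactOperator (ρ x a ∘L ι)
  /-- The domain of `D x` is `W`, for all `x`. -/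
  domain_eq : ∀ x, (D x).domain = LinearMap.range ι.toLinearMap
  /-- The graph norms of the `D x` are uniformly equivalent to the norm of `W`. -/
  graphNorm_equiv : ∃ C₁ C₂ : ℝ, 0 < C₁ ∧ 0 < C₂ ∧ ∀ (x : M) (w : W) (h : ι w ∈ (D x).domain),
    C₁ * ‖w‖ ≤ graphNorm ℂ (D x) ⟨ι w, h⟩ ∧ graphNorm ℂ (D x) ⟨ι w, h⟩ ≤ C₂ * ‖w‖
  /-- `D(·)`, seen as a map `M → 𝓛(W, H)`, has a uniformly bounded weak derivative. -/
  weakDeriv_op : ∃ S : M → W →L[ℂ] H,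
    (∀ (x : M) (w : W) (h : ι w ∈ (D x).domain), S x w = D x ⟨ι w, h⟩) ∧
    HasUniformlyBoundedWeakDeriv m S
  weakDeriv_rep : ∀ a ∈ 𝒜, HasUniformlyBoundedWeakDeriv m fun x => ρ x a
  /-- `x ↦ [D x, ρ x a]`, as a map `M → 𝓛(H)`, is norm continuous. -/
  continuous_commutator : ∀ a ∈ 𝒜, ∃ T : M → H →L[ℂ] H, Continuous T ∧
    ∀ (x : M) (ψ : (D x).domain) (h : ρ x a ψ ∈ (D x).domain),
      T x ψ = D x ⟨ρ x a ψ, h⟩ - ρ x a (D x ψ)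

/-- The image in `C₀(M, A)` of the algebraic tensor product `𝒜 ⊙ C_c^∞(M)`: the span of the
functions `x ↦ f x • a` with `a ∈ 𝒜` and `f : M → ℂ` smooth and compactly supported. -/
def tensorSmooth (m : ℕ) (M : Type*) [TopologicalSpace M]
    [ChartedSpace (EuclideanSpace ℝ (Fin m)) M] {A : Type*} [NonUnitalCStarAlgebra A]
    (𝒜 : NonUnitalStarSubalgebra ℂ A) : NonUnitalStarSubalgebra ℂ C₀(M, A) :=
  let gen : Set C₀(M, A) := {g | ∃ a ∈ 𝒜, ∃ f : M → ℂ, ContMDiff (𝓡 m) 𝓘(ℝ, ℂ) ∞ f ∧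
    HasCompactSupport f ∧ ∀ x, g x = f x • a}
  { Submodule.span ℂ gen with
    mul_mem' := by
      intro g h hg hh
      change g * h ∈ Submodule.span ℂ gen
      induction hg, hh using Submodule.span_induction₂ with
      | mem_mem g h hg hh =>
        obtain ⟨a, ha, f, hf, hfc, hgf⟩ := hg
        obtain ⟨b, hb, k, hk, hkc, hhk⟩ := hh
        refine Submodule.subset_span ⟨a * b, mul_mem ha hb, f * k, ?_, hfc.mul_right, fun x => ?_⟩
        · exact (contDiff_mul.contMDiff).comp (hf.prodMk_space hk)
        · simp [hgf, hhk, smul_mul_smul_comm]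
      | zero_left => simp
      | zero_right => simp
      | add_left => rw [add_mul]; exact add_mem ‹_› ‹_›
      | add_right => rw [mul_add]; exact add_mem ‹_› ‹_›
      | smul_left => rw [smul_mul_assoc]; exact Submodule.smul_mem _ _ ‹_›
      | smul_right => rw [mul_smul_comm]; exact Submodule.smul_mem _ _ ‹_›
    star_mem' := by
      intro g hg
      replace hg : g ∈ Submodule.span ℂ gen := hg
      change star g ∈ Submodule.span ℂ gen
      induction hg using Submodule.span_induction with
      | mem g hg =>
        obtain ⟨a, ha, f, hf, hfc, hgf⟩ := hg
        refine Submodule.subset_span ⟨star a, star_mem ha, fun x => star (f x), ?_, ?_, fun x => ?_⟩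
        · exact (Complex.conjCLE.contDiff.contMDiff).comp hf
        · exact hfc.comp_left (star_zero ℂ)
        · simp [hgf]
      | zero => simp
      | add _ _ _ _ h h' => rw [star_add]; exact add_mem h h'
      | smul _ _ _ h => rw [star_smul]; exact Submodule.smul_mem _ _ h }

end Families

end

/-! Everything is done fibre by fibre, with enough uniformity in `x` to pass to sections. Regard `D
x` as a bounded operator `S x : W → H`. The mean value inequality in a chart turns a uniformly
bounded weak derivative into norm continuity (`HasUniformlyBoundedWeakDeriv.continuous`); this
applies to `S` and to `ρ x a` for `a ∈ 𝒜`, and contractivity of `*`-homomorphisms extends the latter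
to all of `A`.

By symmetry, the norm of `(D x ± i) w` is the graph norm, so it is bounded below by a fixed multiple
of `‖w‖`. Hence the inverses `R x : H → W` are bounded uniformly in `x`, and they are norm
continuous by the resolvent identity (`exists_op`). They act on `C₀` sections, so `D(·) ± i` is
onto; together with symmetry this gives self-adjointness and regularity.

The same `R` settles the remaining axioms. A section `ρ(a)φ` is continuous into `W` because it
equals `R` applied to a continuous `H`-valued section built from the commutator
(`exists_commutator`). For compactness, `ρ(a) ι R` is a norm continuous family of compact operators
vanishing at infinity. A partition of unity approximates it by sums `∑ f i • F i` with `F i` of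
finite rank (`exists_smooth_sum_approx`). Since `D + i` carries the graph inner product to that of
`H`, these sums composed with `D + i` have finite rank on `Dom D`. -/

/-! ### Self-adjointness and regularity from surjectivity of `D ± i`. -/

section SelfAdjoint

variable {B : Type*} {E : Type*} [NonUnitalCommCStarAlgebra B] [PartialOrder B]
  [NormedAddCommGroup E] [NormedSpace ℂ E] [SMul B E] [CStarModule B E]

theorem isClosed_adjointGraph [StarOrderedRing B] (D : E →ₗ.[ℂ] E) : IsClosed (adjointGraph B D) := by
  have : adjointGraph B D =
      ⋂ ψ : D.domain, {p : E × E | inner B (D ψ) p.1 = inner B (ψ : E) p.2} := by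
    ext p; simp [adjointGraph]
  rw [this]
  refine isClosed_iInter fun ψ => isClosed_eq ?_ ?_
  · exact (CStarModule.innerSL (A := B) (D ψ)).continuous.comp continuous_fst
  · exact (CStarModule.innerSL (A := B) (ψ : E)).continuous.comp continuous_snd

/-- A densely defined symmetric operator with `D ± i` surjective is self-adjoint. -/
theorem isSelfAdjointOp_of_surjective (D : E →ₗ.[ℂ] E) (hd : Dense (D.domain : Set E))
    (hsymm : ∀ φ ψ : D.domain, inner B (D φ) (ψ : E) = inner B (φ : E) (D ψ))
    (hplus : ∀ η : E, ∃ φ : D.domain, D φ + Complex.I • (φ : E) = η)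
    (hminus : ∀ η : E, ∃ φ : D.domain, D φ - Complex.I • (φ : E) = η) :
    IsSelfAdjointOp B D := by
  refine ⟨hd, Set.Subset.antisymm ?_ ?_⟩
  · rintro ⟨p, q⟩ hpq ψ
    obtain ⟨φ, rfl, rfl⟩ := (LinearPMap.mem_graph_iff D).mp hpq
    exact hsymm ψ φ
  · rintro ⟨p, q⟩ hpq
    -- With this `φ`, the vector `p - φ` is killed by `D⋆ + i`, hence orthogonal to the range of `D
    -- - i`. That range is everything, so `p - φ` is orthogonal to itself.
    obtain ⟨φ, hφ⟩ := hplus (q + Complex.I • p)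
    obtain ⟨ψ, hψ⟩ := hminus (p - φ)
    have h1 : inner B (D ψ) p = inner B (ψ : E) q := hpq ψ
    have h2 : D φ = q + Complex.I • p - Complex.I • (φ : E) := by rw [← hφ]; abel
    have h0 : inner B (p - φ) (p - φ) = 0 := by
      nth_rewrite 1 [← hψ]
      simp only [CStarModule.inner_sub_left, CStarModule.inner_sub_right,
        CStarModule.inner_smul_left_complex, h1, hsymm, h2, CStarModule.inner_add_right,
        CStarModule.inner_smul_right_complex]
      simp only [Complex.star_def, Complex.conj_I, neg_smul]
      abel
    have hp : p = φ := sub_eq_zero.mp (CStarModule.inner_self.mp h0)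
    refine (LinearPMap.mem_graph_iff D).mpr ⟨φ, hp.symm, ?_⟩
    rw [h2, hp]; simp

/-- A self-adjoint operator with `D ± i` surjective is regular. -/
theorem IsSelfAdjointOp.isRegularOp [StarOrderedRing B] (D : E →ₗ.[ℂ] E) (hD : IsSelfAdjointOp B D)
    (hplus : ∀ η : E, ∃ φ : D.domain, D φ + Complex.I • (φ : E) = η)
    (hminus : ∀ η : E, ∃ φ : D.domain, D φ - Complex.I • (φ : E) = η) :
    IsRegularOp B D := by
  obtain ⟨hd, hg⟩ := hD
  refine ⟨hg ▸ isClosed_adjointGraph D, hd, ?_, ?_⟩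
  · refine hd.mono fun η hη => ⟨D ⟨η, hη⟩, ?_⟩
    rw [← hg]
    exact (LinearPMap.mem_graph_iff D).mpr ⟨⟨η, hη⟩, rfl, rfl⟩
  · convert dense_univ
    refine Set.eq_univ_of_forall fun η => ?_
    -- Factor `1 + D² = (D - i)(D + i)` and invert the factors one after the other; `1 + D⋆D` is
    -- then onto.
    obtain ⟨u, rfl⟩ := hminus η
    obtain ⟨φ, hφ⟩ := hplus u
    have h2 : D φ = u - Complex.I • (φ : E) := by rw [← hφ]; abel
    refine ⟨φ, D (u - Complex.I • φ), ?_, ?_⟩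
    · rw [← hg, h2]
      exact (LinearPMap.mem_graph_iff D).mpr ⟨u - Complex.I • φ, rfl, rfl⟩
    · have h3 : D (u - Complex.I • φ) = D u - Complex.I • D φ := by
        rw [LinearPMap.map_sub, LinearPMap.map_smul]
      rw [h3, h2, smul_sub, smul_smul, Complex.I_mul_I, neg_one_smul]
      abel

end SelfAdjoint

/-! ### Graph norms and finite rank approximation in Hilbert space. -/

section Hilbert

variable {H : Type*} [NormedAddCommGroup H] [InnerProductSpace ℂ H]

/-- Graph norm of an operator on a Hilbert space. -/
theorem graphNorm_complex (D : H →ₗ.[ℂ] H) (φ : D.domain) :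
    graphNorm ℂ D φ = Real.sqrt (‖(φ : H)‖ ^ 2 + ‖D φ‖ ^ 2) := by
  have h1 : graphInner ℂ D φ φ = ((‖(φ : H)‖ ^ 2 + ‖D φ‖ ^ 2 : ℝ) : ℂ) := by
    have := inner_self_eq_norm_sq_to_K (𝕜 := ℂ) (φ : H)
    have h' := inner_self_eq_norm_sq_to_K (𝕜 := ℂ) (D φ)
    push_cast
    exact congrArg₂ (· + ·) this h'
  rw [graphNorm, h1, Complex.norm_of_nonneg (by positivity)]

/-- The operators of the form `ψ ↦ ∑ i, ⟪k i, ψ⟫ h i`. -/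
def finiteRankOps (H : Type*) [NormedAddCommGroup H] [InnerProductSpace ℂ H] :
    Set (H →L[ℂ] H) :=
  {F | ∃ (n : ℕ) (k h : Fin n → H), ∀ ψ, F ψ = ∑ i, (inner ℂ (k i) ψ : ℂ) • h i}

/-- Compact operators on a Hilbert space are norm limits of operators of finite rank. -/
theorem IsCompactOperator.mem_closure_finiteRankOps [CompleteSpace H] {K : H →L[ℂ] H}
    (hK : IsCompactOperator K) : K ∈ closure (finiteRankOps H) := by
  rw [Metric.mem_closure_iff]
  intro ε hε
  have hc : IsCompact (closure (K '' Metric.closedBall 0 1)) :=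
    hK.isCompact_closure_image_closedBall 1
  obtain ⟨t, htf, ht⟩ := Metric.totallyBounded_iff.mp hc.totallyBounded (ε / 2) (half_pos hε)
  let U : Submodule ℂ H := Submodule.span ℂ t
  have : FiniteDimensional ℂ U := FiniteDimensional.span_of_finite ℂ htf
  let b := stdOrthonormalBasis ℂ U
  -- Project onto the span `U` of a finite `ε / 2`-net of the image of the unit ball: the projection
  -- of `K ψ` is at least as close to it as the nearest net point.
  refine ⟨U.starProjection ∘L K, ⟨_, fun i => K.adjoint (b i), fun i => b i, fun ψ => ?_⟩, ?_⟩
  · simp only [ContinuousLinearMap.adjoint_inner_left, ContinuousLinearMap.comp_apply]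
    rw [Submodule.starProjection_apply, ← b.sum_repr' (U.orthogonalProjectionOnto (K ψ))]
    simp
  · rw [dist_eq_norm]
    refine lt_of_le_of_lt ?_ (half_lt_self hε)
    refine ContinuousLinearMap.opNorm_le_of_unit_norm (half_pos hε).le fun ψ hψ => ?_
    obtain ⟨y, hy, hd⟩ := Set.mem_iUnion₂.mp
      (ht (subset_closure (Set.mem_image_of_mem K (mem_closedBall_zero_iff.mpr hψ.le))))
    change ‖K ψ - U.starProjection (K ψ)‖ ≤ ε / 2
    rw [Submodule.starProjection_minimal]
    refine (ciInf_le ⟨0, ?_⟩ (⟨y, Submodule.subset_span hy⟩ : U)).trans ?_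
    · rintro _ ⟨_, rfl⟩; exact norm_nonneg _
    · rw [← dist_eq_norm]; exact (Metric.mem_ball.mp hd).le

end Hilbert

/-! ### Uniform approximation by smooth partitions of unity. -/

section Approximation

open Set Filter Topology

/-- A continuous map vanishing at infinity is approximated, uniformly, by finite sums of vectors
from a set whose closure contains its values, with smooth coefficients of compact support. -/
theorem exists_smooth_sum_approx {m : ℕ} {M : Type*} [TopologicalSpace M] [T2Space M]
    [SecondCountableTopology M] [ChartedSpace (EuclideanSpace ℝ (Fin m)) M]
    [IsManifold (𝓡 m) ∞ M] {V : Type*} [NormedAddCommGroup V] [NormedSpace ℝ V]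
    (S : Set V) (g : M → V) (hg : Continuous g) (hg0 : Tendsto g (cocompact M) (𝓝 0))
    (hS : ∀ x, g x ∈ closure S) {ε : ℝ} (hε : 0 < ε) :
    ∃ (n : ℕ) (f : Fin n → M → ℝ) (v : Fin n → V),
      (∀ i, ContMDiff (𝓡 m) 𝓘(ℝ, ℝ) ∞ (f i)) ∧ (∀ i, HasCompactSupport (f i)) ∧
      (∀ i x, 0 ≤ f i x) ∧ (∀ i, v i ∈ S) ∧ ∀ x, ‖g x - ∑ i, f i x • v i‖ ≤ ε := by
  have : LocallyCompactSpace M := ChartedSpace.locallyCompactSpace (EuclideanSpace ℝ (Fin m)) M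
  obtain ⟨K, hK, hKg⟩ : ∃ K : Set M, IsCompact K ∧ ∀ x ∉ K, ‖g x‖ ≤ ε := by
    obtain ⟨K, hK, hKs⟩ := mem_cocompact.mp (hg0 (Metric.closedBall_mem_nhds 0 hε))
    exact ⟨K, hK, fun x hx => by simpa using hKs hx⟩
  choose v hvS hv using fun x => Metric.mem_closure_iff.mp (hS x) ε hε
  choose C hC hxC using fun x : M => exists_compact_mem_nhds x
  -- Intersecting with the interior of a compact neighbourhood makes the subordinate functions
  -- compactly supported.
  let U : M → Set M := fun x => {y | dist (g y) (v x) < ε} ∩ interior (C x)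
  have hUo : ∀ x, IsOpen (U x) := fun x =>
    (isOpen_lt (hg.dist continuous_const) continuous_const).inter isOpen_interior
  have hxU : ∀ x, x ∈ U x := fun x => ⟨hv x, mem_interior_iff_mem_nhds.mpr (hxC x)⟩
  obtain ⟨t, -, ht⟩ := hK.elim_nhds_subcover U fun x _ => (hUo x).mem_nhds (hxU x)
  obtain ⟨f, hf⟩ := SmoothPartitionOfUnity.exists_isSubordinate (𝓡 m) hK.isClosed
    (fun i : t => U i) (fun i => hUo i) (by simpa [iUnion_subtype] using ht)
  let e := t.equivFin
  have hsum : ∀ x, ∑ i : t, f i x = ∑ᶠ i, f i x := fun x =>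
    (finsum_eq_sum_of_fintype _).symm
  refine ⟨t.card, fun i => f (e.symm i), fun i => v (e.symm i), fun i => (f _).contMDiff,
    fun i => ?_, fun i x => f.nonneg _ _, fun i => hvS _, fun x => ?_⟩
  · exact HasCompactSupport.of_support_subset_isCompact (hC (e.symm i))
      ((subset_tsupport _).trans ((hf _).trans (inter_subset_right.trans interior_subset)))
  · rw [e.symm.sum_comp (fun i : t => f i x • v i)]
    -- On `K` the partition sums to one and the first term vanishes; off `K` the value `g x` is
    -- itself small. The weights add up to one, so the two errors combine to `ε`.
    have hdecomp : g x - ∑ i : t, f i x • v i =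
        (1 - ∑ i : t, f i x) • g x + ∑ i : t, f i x • (g x - v i) := by
      simp only [smul_sub, Finset.sum_sub_distrib, ← Finset.sum_smul, sub_smul, one_smul]
      abel
    have h1 : ∑ i : t, f i x ≤ 1 := by rw [hsum]; exact f.sum_le_one x
    have h2 : ‖(1 - ∑ i : t, f i x) • g x‖ ≤ (1 - ∑ i : t, f i x) * ε := by
      by_cases hx : x ∈ K
      · have : ∑ i : t, f i x = 1 := by rw [hsum]; exact f.sum_eq_one hx
        rw [this, sub_self, zero_smul, zero_mul, norm_zero]
      · rw [norm_smul, Real.norm_of_nonneg (sub_nonneg.mpr h1)]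
        exact mul_le_mul_of_nonneg_left (hKg x hx) (sub_nonneg.mpr h1)
    have h3 : ‖∑ i : t, f i x • (g x - v i)‖ ≤ (∑ i : t, f i x) * ε := by
      rw [Finset.sum_mul]
      refine norm_sum_le_of_le _ fun i _ => ?_
      rw [norm_smul, Real.norm_of_nonneg (f.nonneg i x)]
      by_cases hx : f i x = 0
      · simp [hx]
      · have hxU : x ∈ U i := hf i (subset_tsupport _ hx)
        refine mul_le_mul_of_nonneg_left ?_ (f.nonneg i x)
        rw [← dist_eq_norm]; exact hxU.1.le
    calc ‖g x - ∑ i : t, f i x • v i‖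
        ≤ (1 - ∑ i : t, f i x) * ε + (∑ i : t, f i x) * ε := by
          rw [hdecomp]; exact (norm_add_le _ _).trans (add_le_add h2 h3)
      _ = ε := by ring

end Approximation

/-! ### Separability of `C₀(M, V)`. -/

section ZeroAtInfty

open Filter Topology Set

/-- A continuous map of compact support, as a map vanishing at infinity. -/
def c0OfCompactSupport {M V : Type*} [TopologicalSpace M] [NormedAddCommGroup V] (f : M → V)
    (hf : Continuous f) (hc : HasCompactSupport f) : C₀(M, V) :=
  ⟨⟨f, hf⟩, hc.is_zero_at_infty⟩

theorem c0_norm_apply_le {M V : Type*} [TopologicalSpace M] [NormedAddCommGroup V]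
    (f : C₀(M, V)) (x : M) : ‖f x‖ ≤ ‖f‖ :=
  (C0Module.norm_le_iff f (norm_nonneg f)).mp le_rfl x

theorem c0_sum_apply {M V α : Type*} [TopologicalSpace M] [NormedAddCommGroup V]
    (s : Finset α) (f : α → C₀(M, V)) (x : M) : (∑ i ∈ s, f i) x = ∑ i ∈ s, f i x :=
  map_sum (⟨⟨fun f : C₀(M, V) => f x, rfl⟩, fun _ _ => rfl⟩ : C₀(M, V) →+ V) f s

/-- The maps vanishing outside a compact set form a separable set. -/
theorem isSeparable_setOf_eqOn_compl {M V : Type*} [TopologicalSpace M] [T2Space M]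
    [SecondCountableTopology M] [NormedAddCommGroup V] [SecondCountableTopology V]
    {K : Set M} (hK : IsCompact K) :
    TopologicalSpace.IsSeparable {f : C₀(M, V) | ∀ x ∉ K, f x = 0} := by
  have : CompactSpace K := isCompact_iff_compactSpace.mp hK
  let S : Set C₀(M, V) := {f | ∀ x ∉ K, f x = 0}
  -- Restriction embeds these maps isometrically into `C(K, V)`, which is second countable.
  let r : S → C(K, V) := fun f => (f : C₀(M, V)).toContinuousMap.restrict K
  have hr : Isometry r := by
    refine Isometry.of_dist_eq fun f g => le_antisymm ?_ ?_
    · refine (ContinuousMap.dist_le dist_nonneg).mpr fun x => ?_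
      change dist ((f : C₀(M, V)) x) ((g : C₀(M, V)) x) ≤ dist (f : C₀(M, V)) g
      rw [dist_eq_norm, dist_eq_norm]
      exact c0_norm_apply_le ((f : C₀(M, V)) - (g : C₀(M, V))) x
    · change dist (f : C₀(M, V)) g ≤ _
      rw [dist_eq_norm, C0Module.norm_le_iff _ dist_nonneg]
      intro x
      by_cases hx : x ∈ K
      · rw [ZeroAtInftyContinuousMap.sub_apply, ← dist_eq_norm]
        exact ContinuousMap.dist_apply_le_dist (f := r f) (g := r g) ⟨x, hx⟩
      · simp [f.2 x hx, g.2 x hx]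
  have : SecondCountableTopology S := hr.isEmbedding.secondCountableTopology
  exact TopologicalSpace.IsSeparable.of_subtype S

/-- `C₀(M, V)` is separable for a second countable manifold `M` and a separable space `V`. -/
theorem separableSpace_zeroAtInfty (m : ℕ) {M : Type*} [TopologicalSpace M] [T2Space M]
    [SecondCountableTopology M] [ChartedSpace (EuclideanSpace ℝ (Fin m)) M]
    [IsManifold (𝓡 m) ∞ M] {V : Type*} [NormedAddCommGroup V] [NormedSpace ℝ V]
    [SecondCountableTopology V] : TopologicalSpace.SeparableSpace C₀(M, V) := by
  have : LocallyCompactSpace M := ChartedSpace.locallyCompactSpace (EuclideanSpace ℝ (Fin m)) M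
  rw [← TopologicalSpace.isSeparable_univ_iff]
  let K := CompactExhaustion.choice M
  have h1 : TopologicalSpace.IsSeparable
      (closure (⋃ n, {f : C₀(M, V) | ∀ x ∉ K n, f x = 0})) :=
    (TopologicalSpace.IsSeparable.iUnion fun n =>
      isSeparable_setOf_eqOn_compl (K.isCompact n)).closure
  refine h1.mono fun g _ => Metric.mem_closure_iff.mpr fun ε hε => ?_
  obtain ⟨n, f, v, hf, hfc, -, -, hfg⟩ := exists_smooth_sum_approx (m := m) univ g
    (map_continuous g) (zero_at_infty g) (by simp) (half_pos hε)
  let h : C₀(M, V) := ∑ i, c0OfCompactSupport (fun x => f i x • v i)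
    ((hf i).continuous.smul continuous_const) (hfc i).smul_right
  have hh : ∀ x, h x = ∑ i, f i x • v i := fun x => c0_sum_apply _ _ x
  obtain ⟨N, hN⟩ := K.exists_superset_of_isCompact (isCompact_iUnion fun i => hfc i)
  refine ⟨h, mem_iUnion.mpr ⟨N, fun x hx => ?_⟩, ?_⟩
  · rw [hh]
    refine Finset.sum_eq_zero fun i _ => ?_
    rw [image_eq_zero_of_notMem_tsupport fun h' => hx (hN (mem_iUnion.mpr ⟨i, h'⟩)), zero_smul]
  · refine lt_of_le_of_lt ?_ (half_lt_self hε)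
    rw [dist_eq_norm, C0Module.norm_le_iff _ (half_pos hε).le]
    intro x
    rw [ZeroAtInftyContinuousMap.sub_apply, hh]
    exact hfg x

end ZeroAtInfty

/-! ### From bounded weak derivatives to norm continuity. -/

section Mean

open Filter Topology Set

theorem IsContMDiffRiemannianBundle.isContinuousRiemannianBundle {m : ℕ} {M : Type*}
    [TopologicalSpace M] [ChartedSpace (EuclideanSpace ℝ (Fin m)) M]
    [IsManifold (𝓡 m) ∞ M] [Bundle.RiemannianBundle (fun x : M => TangentSpace (𝓡 m) x)]
    [h : IsContMDiffRiemannianBundle (𝓡 m) ∞ (EuclideanSpace ℝ (Fin m))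
      (fun x : M => TangentSpace (𝓡 m) x)] :
    IsContinuousRiemannianBundle (EuclideanSpace ℝ (Fin m))
      (fun x : M => TangentSpace (𝓡 m) x) := by
  obtain ⟨g, hg, hg'⟩ := h.exists_contMDiff
  exact ⟨g, hg.continuous, hg'⟩

attribute [local instance] normedAddCommGroupTangentSpaceVectorSpace
  normedSpaceTangentSpaceVectorSpace

/-- A map with uniformly bounded weak derivative is continuous for the operator norm. -/
theorem HasUniformlyBoundedWeakDeriv.continuous {m : ℕ} {M : Type*} [TopologicalSpace M]
    [ChartedSpace (EuclideanSpace ℝ (Fin m)) M]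
    [IsManifold (𝓡 m) ∞ M] [Bundle.RiemannianBundle (fun x : M => TangentSpace (𝓡 m) x)]
    [IsContMDiffRiemannianBundle (𝓡 m) ∞ (EuclideanSpace ℝ (Fin m))
      (fun x : M => TangentSpace (𝓡 m) x)]
    {H₁ H₂ : Type*} [NormedAddCommGroup H₁] [InnerProductSpace ℂ H₁]
    [NormedAddCommGroup H₂] [InnerProductSpace ℂ H₂] {S : M → H₁ →L[ℂ] H₂}
    (hS : HasUniformlyBoundedWeakDeriv m S) : Continuous S := by
  obtain ⟨hd, dS, hdS, C, hC⟩ := hS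
  have : IsManifold (𝓡 m) 1 M := IsManifold.of_le (n := ∞) (by simp)
  have : IsContinuousRiemannianBundle (EuclideanSpace ℝ (Fin m))
      (fun x : M => TangentSpace (𝓡 m) x) :=
    IsContMDiffRiemannianBundle.isContinuousRiemannianBundle
  rw [continuous_iff_continuousAt]
  intro x
  -- `C'` compares the Euclidean norm of the chart with the Riemannian norm near `x`. This is where
  -- the metric enters; only local information is used, so completeness of `M` plays no role.
  obtain ⟨C', hC'0, hC'⟩ := eventually_norm_mfderivWithin_symm_extChartAt_lt (𝓡 m) x
  have hrange : range (𝓡 m) = univ := ModelWithCorners.range_eq_univ _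
  set φ := extChartAt (𝓡 m) x
  have hφC : ∀ᶠ y in 𝓝 (φ x), ∀ u : EuclideanSpace ℝ (Fin m),
      ‖mfderiv 𝓘(ℝ, EuclideanSpace ℝ (Fin m)) (𝓡 m) φ.symm y u‖ ≤ C' * ‖u‖ := by
    rw [hrange, nhdsWithin_univ] at hC'
    filter_upwards [hC'] with y hy u
    rw [mfderivWithin_univ] at hy
    exact (ContinuousLinearMap.le_opNorm _ u).trans
      (mul_le_mul_of_nonneg_right hy.le (norm_nonneg _))
  obtain ⟨r, r_pos, hr⟩ := Metric.mem_nhds_iff.mp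
    (inter_mem (extChartAt_target_mem_nhds (I := 𝓡 m) x) hφC)
  have key : ∀ z ∈ Metric.ball (φ x) r,
      ‖S (φ.symm z) - S x‖ ≤ |C| * C' * ‖z - φ x‖ := by
    intro z hz
    refine ContinuousLinearMap.opNorm_le_bound _ (by positivity) fun ξ => ?_
    -- A bound on matrix coefficients, uniform in `η`, becomes a norm bound by testing with `η = (S
    -- (φ.symm z) - S x) ξ` and cancelling one factor.
    suffices h : ∀ η, ‖(inner ℂ η ((S (φ.symm z) - S x) ξ) : ℂ)‖ ≤
        |C| * C' * ‖z - φ x‖ * ‖ξ‖ * ‖η‖ by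
      have h' := h ((S (φ.symm z) - S x) ξ)
      rw [inner_self_eq_norm_sq_to_K] at h'
      rcases (norm_nonneg ((S (φ.symm z) - S x) ξ)).eq_or_lt' with h0 | h0
      · rw [h0]; positivity
      · refine le_of_mul_le_mul_right ?_ h0
        simpa [sq] using h'
    intro η
    let f : M → ℂ := fun y => inner ℂ η (S y ξ)
    have hder : ∀ w ∈ Metric.ball (φ x) r, ∃ f' : EuclideanSpace ℝ (Fin m) →L[ℝ] ℂ,
        HasFDerivAt (f ∘ φ.symm) f' w ∧ ‖f'‖ ≤ |C| * C' * ‖ξ‖ * ‖η‖ := by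
      intro w hw
      have h1 : MDifferentiableWithinAt 𝓘(ℝ, EuclideanSpace ℝ (Fin m)) (𝓡 m) φ.symm
        (range (𝓡 m)) w := mdifferentiableWithinAt_extChartAt_symm (hr hw).1
      rw [hrange, mdifferentiableWithinAt_univ] at h1
      have h3 := ((hd ξ η (φ.symm w)).hasMFDerivAt).comp w h1.hasMFDerivAt
      refine ⟨_, hasMFDerivAt_iff_hasFDerivAt.mp h3, ?_⟩
      refine ContinuousLinearMap.opNorm_le_bound _ (by positivity) fun u => ?_
      set v := mfderiv 𝓘(ℝ, EuclideanSpace ℝ (Fin m)) (𝓡 m) φ.symm w u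
      have hv : ‖v‖ ≤ C' * ‖u‖ := (hr hw).2 u
      change ‖mfderiv (𝓡 m) 𝓘(ℝ, ℂ) (fun y => (inner ℂ η (S y ξ) : ℂ)) (φ.symm w) v‖ ≤ _
      rw [hdS]
      calc ‖(inner ℂ η (dS (φ.symm w) v ξ) : ℂ)‖ ≤ ‖η‖ * (‖dS (φ.symm w) v‖ * ‖ξ‖) :=
            (norm_inner_le_norm _ _).trans (by gcongr; exact ContinuousLinearMap.le_opNorm _ _)
        _ ≤ ‖η‖ * (|C| * (C' * ‖u‖) * ‖ξ‖) := by
            gcongr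
            exact (hC _ v).trans (mul_le_mul (le_abs_self C) hv (norm_nonneg _) (abs_nonneg C))
        _ = |C| * C' * ‖ξ‖ * ‖η‖ * ‖u‖ := by ring
    choose! f' hf' hf'b using hder
    have := (convex_ball (φ x) r).norm_image_sub_le_of_norm_hasFDerivWithin_le
      (fun w hw => (hf' w hw).hasFDerivWithinAt) hf'b (Metric.mem_ball_self r_pos) hz
    have hx : φ.symm (φ x) = x := extChartAt_to_inv x
    simp only [Function.comp_apply, hx, f] at this
    rw [sub_apply, inner_sub_right]
    exact this.trans_eq (by ring)
  have hφ : ContinuousAt φ x := continuousAt_extChartAt x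
  rw [ContinuousAt, tendsto_iff_norm_sub_tendsto_zero]
  have hlim : Tendsto (fun y => |C| * C' * ‖φ y - φ x‖) (𝓝 x) (𝓝 0) := by
    have := (tendsto_iff_norm_sub_tendsto_zero.mp hφ).const_mul (|C| * C')
    simpa using this
  refine squeeze_zero' (Eventually.of_forall fun _ => norm_nonneg _) ?_ hlim
  filter_upwards [hφ.preimage_mem_nhds (Metric.ball_mem_nhds _ r_pos),
    extChartAt_source_mem_nhds (I := 𝓡 m) x] with y hy hys
  have := key (φ y) hy
  rwa [φ.left_inv hys] at this

end Mean

/-! ### Bounded families of operators acting on sections. -/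

section Pointwise

open Filter Topology

variable {M : Type*} [TopologicalSpace M]

/-- Split `T y (ψ y) - T x (ψ x)` as `T y (ψ y - ψ x) + (T y - T x) (ψ x)`: the uniform bound
controls the first term, strong continuity the second. -/
theorem continuous_apply_of_strong {V V' : Type*} [NormedAddCommGroup V] [NormedSpace ℂ V]
    [NormedAddCommGroup V'] [NormedSpace ℂ V'] {T : M → V →L[ℂ] V'}
    (hT : ∀ v, Continuous fun x => T x v) {C : ℝ} (hC : ∀ x, ‖T x‖ ≤ C)
    {ψ : M → V} (hψ : Continuous ψ) : Continuous fun x => T x (ψ x) := by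
  rw [continuous_iff_continuousAt]
  intro x
  have h1 : Tendsto (fun y => C * ‖ψ y - ψ x‖) (𝓝 x) (𝓝 0) := by
    simpa using (tendsto_iff_norm_sub_tendsto_zero.mp (hψ.tendsto x)).const_mul C
  have h2 : Tendsto (fun y => T y (ψ y - ψ x)) (𝓝 x) (𝓝 0) :=
    squeeze_zero_norm (fun y => (T y).le_of_opNorm_le (hC y) _) h1
  have h3 := h2.add ((hT (ψ x)).tendsto x)
  simpa [ContinuousAt] using h3

/-- The operator on `C₀` sections defined by a bounded, strongly continuous family. -/
noncomputable def c0Map {V V' : Type*} [NormedAddCommGroup V] [NormedSpace ℂ V]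
    [NormedAddCommGroup V'] [NormedSpace ℂ V'] (T : M → V →L[ℂ] V')
    (hT : ∀ v, Continuous fun x => T x v) (C : ℝ) (hC : ∀ x, ‖T x‖ ≤ C) :
    C₀(M, V) →L[ℂ] C₀(M, V') :=
  LinearMap.mkContinuous
    { toFun := fun ψ => ⟨⟨fun x => T x (ψ x), continuous_apply_of_strong hT hC (map_continuous ψ)⟩,
        squeeze_zero_norm (fun x => (T x).le_of_opNorm_le (hC x) _)
          (by simpa using (zero_at_infty ψ).norm.const_mul C)⟩
      map_add' := fun φ ψ => ZeroAtInftyContinuousMap.ext fun x => (T x).map_add _ _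
      map_smul' := fun c ψ => ZeroAtInftyContinuousMap.ext fun x => (T x).map_smul _ _ }
    |C| fun ψ => (C0Module.norm_le_iff _ (by positivity)).mpr fun x =>
      (T x).le_of_opNorm_le_of_le ((hC x).trans (le_abs_self C)) (c0_norm_apply_le ψ x)

/-- Pointwise inverses of a continuous family of surjective operators, uniformly bounded below,
form a bounded continuous family. -/
theorem exists_continuous_inverse {V V' : Type*} [NormedAddCommGroup V] [NormedSpace ℂ V]
    [NormedAddCommGroup V'] [NormedSpace ℂ V'] {T : M → V →L[ℂ] V'}
    (hT : Continuous T) {c : ℝ} (hc : 0 < c) (hb : ∀ x v, c * ‖v‖ ≤ ‖T x v‖)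
    (hs : ∀ x, Function.Surjective (T x)) :
    ∃ R : M → V' →L[ℂ] V, (∀ x w, T x (R x w) = w) ∧ (∀ x v, R x (T x v) = v) ∧
      Continuous R ∧ ∀ x, ‖R x‖ ≤ c⁻¹ := by
  have hinj : ∀ x, Function.Injective (T x) := fun x => by
    refine (injective_iff_map_eq_zero _).mpr fun v hv => norm_le_zero_iff.mp ?_
    have := hb x v
    rw [hv, norm_zero] at this
    exact nonpos_of_mul_nonpos_right this hc
  let e : ∀ x, V ≃ₗ[ℂ] V' := fun x => LinearEquiv.ofBijective (T x).toLinearMap ⟨hinj x, hs x⟩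
  have he : ∀ x w, T x ((e x).symm w) = w := fun x w => (e x).apply_symm_apply w
  let R : M → V' →L[ℂ] V := fun x => (e x).symm.toLinearMap.mkContinuous c⁻¹ fun w => by
    have := hb x ((e x).symm w)
    rw [he] at this
    change ‖(e x).symm w‖ ≤ _
    rwa [inv_mul_eq_div, le_div_iff₀' hc]
  have hR : ∀ x, ‖R x‖ ≤ c⁻¹ := fun x => LinearMap.mkContinuous_norm_le _ (by positivity) _
  have hTR : ∀ x w, T x (R x w) = w := he
  have hRT : ∀ x v, R x (T x v) = v := fun x v => (e x).symm_apply_apply v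
  refine ⟨R, hTR, hRT, ?_, hR⟩
  rw [continuous_iff_continuousAt]
  intro x
  rw [ContinuousAt, tendsto_iff_norm_sub_tendsto_zero]
  have hlim : Tendsto (fun y => c⁻¹ * ‖T y - T x‖ * c⁻¹) (𝓝 x) (𝓝 0) := by
    simpa using ((tendsto_iff_norm_sub_tendsto_zero.mp (hT.tendsto x)).const_mul c⁻¹).mul_const c⁻¹
  refine squeeze_zero (fun _ => norm_nonneg _) (fun y => ?_) hlim
  -- The resolvent identity, which with the uniform bound on `R` transfers norm continuity from `T`
  -- to `R`.
  have : R y - R x = -((R y ∘L (T y - T x)) ∘L R x) := by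
    ext w
    simp [hTR, hRT]
  rw [this, norm_neg]
  calc _ ≤ ‖R y‖ * ‖T y - T x‖ * ‖R x‖ :=
        (ContinuousLinearMap.opNorm_comp_le _ _).trans
          (mul_le_mul_of_nonneg_right (ContinuousLinearMap.opNorm_comp_le _ _) (norm_nonneg _))
    _ ≤ _ := by gcongr <;> exact hR _

end Pointwise

/-! ### Self-adjoint operators and representations on a single fibre. -/

section Hilbert

variable {H : Type*} [NormedAddCommGroup H] [InnerProductSpace ℂ H]

theorem IsSelfAdjointOp.symm {D : H →ₗ.[ℂ] H} (hD : IsSelfAdjointOp ℂ D) (φ ψ : D.domain) :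
    (inner ℂ (D φ) (ψ : H) : ℂ) = inner ℂ (φ : H) (D ψ) := by
  have : ((ψ : H), D ψ) ∈ adjointGraph ℂ D := hD.2 ▸ LinearPMap.mem_graph D ψ
  exact this φ

/-- The cross term `2 Re (c ⟪u, v⟫)` vanishes, since `c` is purely imaginary and `⟪u, v⟫` is real.
The conditions on `c` treat `i` and `-i` at once; with `u = D v` the right side is the squared graph
norm. -/
theorem norm_sq_add_smul_of_symm {u v : H} {c : ℂ} (h : (inner ℂ u v : ℂ) = inner ℂ v u)
    (hc : star c = -c) (hc' : c * c = -1) : ‖u + c • v‖ ^ 2 = ‖v‖ ^ 2 + ‖u‖ ^ 2 := by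
  have hn : ‖c‖ = 1 := by
    have : ‖c‖ * ‖c‖ = 1 := by rw [← norm_mul, hc']; simp
    nlinarith [norm_nonneg c]
  have h2 : (inner ℂ u v : ℂ).im = 0 := by
    have := inner_conj_symm (𝕜 := ℂ) u v
    rw [← h] at this
    exact Complex.conj_eq_iff_im.mp this
  have h3 : c.re = 0 := by
    have := congrArg Complex.re hc
    simp at this
    linarith
  rw [@norm_add_sq ℂ, inner_smul_right, norm_smul, hn]
  simp [h2, h3]
  ring

/-- A vector `η` orthogonal to the range of `D + c` lies in `Dom D⋆ = Dom D` with `D η = c η`, and a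
symmetric operator has no nonzero eigenvector with imaginary eigenvalue `c ≠ 0`. -/
theorem IsSelfAdjointOp.denseRange_add_smul [CompleteSpace H] {D : H →ₗ.[ℂ] H}
    (hD : IsSelfAdjointOp ℂ D) {c : ℂ} (hc : star c = -c) (hc' : c * c = -1) (U : Submodule ℂ H)
    (hU : ∀ φ : D.domain, D φ + c • (φ : H) ∈ U) : Dense (U : Set H) := by
  rw [Submodule.dense_iff_topologicalClosure_eq_top, Submodule.topologicalClosure_eq_top_iff,
    Submodule.eq_bot_iff]
  intro η hη
  have h1 : (η, c • η) ∈ adjointGraph ℂ D := fun φ => by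
    have h2 : (inner ℂ (D φ + c • (φ : H)) η : ℂ) = 0 := hη _ (hU φ)
    rw [inner_add_left, inner_smul_left, ← Complex.star_def, hc] at h2
    change (inner ℂ (D φ) η : ℂ) = inner ℂ (φ : H) (c • η)
    rw [inner_smul_right]
    linear_combination h2
  rw [← hD.2] at h1
  obtain ⟨φ, rfl, h3⟩ := (LinearPMap.mem_graph_iff D).mp h1
  have h4 := hD.symm φ φ
  rw [h3, inner_smul_left, inner_smul_right, ← Complex.star_def, hc] at h4
  have hc0 : c ≠ 0 := by rintro rfl; simp at hc'
  have h5 : (2 * c) * (inner ℂ (φ : H) (φ : H) : ℂ) = 0 := by linear_combination -h4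
  simpa [hc0] using h5

theorem norm_apply_le_of_star_hom [CompleteSpace H] {A : Type*} [NonUnitalCStarAlgebra A]
    (ρ : A →ₙₐ[ℂ] (H →L[ℂ] H))
    (hρ : ∀ (a : A) (φ ψ : H), (inner ℂ (ρ a φ) ψ : ℂ) = inner ℂ φ (ρ (star a) ψ)) (a : A) :
    ‖ρ a‖ ≤ ‖a‖ := by
  let ρ' : A →⋆ₙₐ[ℂ] (H →L[ℂ] H) :=
    { ρ with
      map_star' := fun a => by
        change ρ (star a) = star (ρ a)
        rw [ContinuousLinearMap.star_eq_adjoint, ContinuousLinearMap.eq_adjoint_iff]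
        intro φ ψ
        rw [← inner_conj_symm, ← hρ, inner_conj_symm] }
  exact NonUnitalStarAlgHom.norm_apply_le ρ' a

end Hilbert

/-! ### Norm continuity of the representations and resolvents of the family. -/

namespace IsWeaklyDifferentiableFamily

variable {m : ℕ} {M : Type*} [TopologicalSpace M]
    [ChartedSpace (EuclideanSpace ℝ (Fin m)) M]
    [IsManifold (𝓡 m) ∞ M] [Bundle.RiemannianBundle (fun x : M => TangentSpace (𝓡 m) x)]
    [IsContMDiffRiemannianBundle (𝓡 m) ∞ (EuclideanSpace ℝ (Fin m))
      (fun x : M => TangentSpace (𝓡 m) x)]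
    {A : Type*} [NonUnitalCStarAlgebra A] {𝒜 : NonUnitalStarSubalgebra ℂ A}
    {H : Type*} [NormedAddCommGroup H] [InnerProductSpace ℂ H] [CompleteSpace H]
    {W : Type*} [NormedAddCommGroup W] [InnerProductSpace ℂ W]
    {ρ : M → A →ₙₐ[ℂ] (H →L[ℂ] H)} {D : M → H →ₗ.[ℂ] H} {ι : W →L[ℂ] H}

omit [IsManifold (𝓡 m) ∞ M] [IsContMDiffRiemannianBundle (𝓡 m) ∞ (EuclideanSpace ℝ (Fin m))
      (fun x : M => TangentSpace (𝓡 m) x)] in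
theorem mem_domain (hfam : IsWeaklyDifferentiableFamily m 𝒜 ρ D ι) (x : M) (w : W) :
    ι w ∈ (D x).domain := by
  rw [hfam.domain_eq]; exact ⟨w, rfl⟩

omit [IsManifold (𝓡 m) ∞ M] [IsContMDiffRiemannianBundle (𝓡 m) ∞ (EuclideanSpace ℝ (Fin m))
      (fun x : M => TangentSpace (𝓡 m) x)] in
theorem norm_rep_le (hfam : IsWeaklyDifferentiableFamily m 𝒜 ρ D ι) (x : M) (a : A) :
    ‖ρ x a‖ ≤ ‖a‖ :=
  norm_apply_le_of_star_hom (ρ x) (hfam.spectralTriple x).star_hom a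

/-- Contractivity makes approximation of `a` by elements of `𝒜` uniform in `x`, and uniform limits
of continuous maps are continuous. -/
theorem continuous_rep (hfam : IsWeaklyDifferentiableFamily m 𝒜 ρ D ι) (a : A) :
    Continuous fun x => ρ x a := by
  rcases isEmpty_or_nonempty M with hM | ⟨⟨x₀⟩⟩
  · exact continuous_of_const fun x => hM.elim x
  refine continuous_of_uniform_approx_of_continuous fun u hu => ?_
  obtain ⟨ε, hε, hu⟩ := Metric.mem_uniformity_dist.mp hu
  obtain ⟨b, hb, hab⟩ := Metric.mem_closure_iff.mp ((hfam.spectralTriple x₀).dense a) ε hε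
  refine ⟨_, (hfam.weakDeriv_rep b hb).continuous, fun x => hu ?_⟩
  rw [dist_eq_norm] at hab ⊢
  rw [← map_sub]
  exact (hfam.norm_rep_le x _).trans_lt hab

theorem continuous_rep_apply (hfam : IsWeaklyDifferentiableFamily m 𝒜 ρ D ι) {a : M → A}
    (ha : Continuous a) : Continuous fun x => ρ x (a x) := by
  let L : M → A →L[ℂ] (H →L[ℂ] H) := fun x =>
    (LinearMap.mkContinuous { ρ x with } 1 fun a => by simpa using hfam.norm_rep_le x a)
  exact continuous_apply_of_strong (T := L) (C := 1) (fun a => hfam.continuous_rep a)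
    (fun x => LinearMap.mkContinuous_norm_le _ zero_le_one _) ha

/-- The operators `D x`, as operators on the common domain `W`. -/
theorem exists_op [CompleteSpace W] (hfam : IsWeaklyDifferentiableFamily m 𝒜 ρ D ι) :
    ∃ S : M → W →L[ℂ] H, Continuous S ∧ (∃ C, ∀ x, ‖S x‖ ≤ C) ∧
      (∀ x w, S x w = D x ⟨ι w, hfam.mem_domain x w⟩) ∧
      (∀ x v w, (inner ℂ (S x v) (ι w) : ℂ) = inner ℂ (ι v) (S x w)) ∧
      ∀ c : ℂ, star c = -c → c * c = -1 →
        ∃ R : M → H →L[ℂ] W, (∀ x η, S x (R x η) + c • ι (R x η) = η) ∧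
          (∀ x w, R x (S x w + c • ι w) = w) ∧ Continuous R ∧ ∃ C, ∀ x, ‖R x‖ ≤ C := by
  obtain ⟨S, hSD, hS⟩ := hfam.weakDeriv_op
  obtain ⟨C₁, C₂, hC₁, hC₂, hC⟩ := hfam.graphNorm_equiv
  have hSc := hS.continuous
  have hSD' := fun x w => hSD x w (hfam.mem_domain x w)
  have hsymm : ∀ x v w, (inner ℂ (S x v) (ι w) : ℂ) = inner ℂ (ι v) (S x w) := fun x v w => by
    rw [hSD', hSD']
    exact (hfam.spectralTriple x).selfAdjoint.symm ⟨ι v, _⟩ ⟨ι w, _⟩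
  have hgn : ∀ x w, graphNorm ℂ (D x) ⟨ι w, hfam.mem_domain x w⟩ =
      Real.sqrt (‖ι w‖ ^ 2 + ‖S x w‖ ^ 2) := fun x w => by
    rw [graphNorm_complex, hSD']
  refine ⟨S, hSc, ⟨C₂, fun x => ?_⟩, hSD', hsymm, fun c hc hc' => ?_⟩
  · refine ContinuousLinearMap.opNorm_le_bound _ hC₂.le fun w => ?_
    refine le_trans ?_ (hC x w (hfam.mem_domain x w)).2
    rw [hgn]
    exact Real.le_sqrt_of_sq_le (le_add_of_nonneg_left (sq_nonneg _))
  · let T : M → W →L[ℂ] H := fun x => S x + c • ι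
    have hT : Continuous T := hSc.add continuous_const
    have hb : ∀ x w, C₁ * ‖w‖ ≤ ‖T x w‖ := fun x w => by
      refine (hC x w (hfam.mem_domain x w)).1.trans ?_
      rw [hgn, ← norm_sq_add_smul_of_symm (hsymm x w w) hc hc',
        Real.sqrt_sq (norm_nonneg _)]
      exact le_rfl
    have hs : ∀ x, Function.Surjective (T x) := fun x => by
      -- The lower bound and completeness of `W` make the range closed; self-adjointness makes it
      -- dense.
      have hanti : AntilipschitzWith (⟨C₁⁻¹, by positivity⟩ : NNReal) (T x) := by
        refine (T x).antilipschitz_of_bound fun w => ?_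
        change ‖w‖ ≤ C₁⁻¹ * ‖T x w‖
        rw [inv_mul_eq_div, le_div_iff₀' hC₁]
        exact hb x w
      have hcl := hanti.isClosed_range (T x).uniformContinuous
      have hdense : Dense ((LinearMap.range (T x).toLinearMap : Submodule ℂ H) : Set H) := by
        refine (hfam.spectralTriple x).selfAdjoint.denseRange_add_smul hc hc' _ fun φ => ?_
        obtain ⟨w, hw⟩ : (φ : H) ∈ LinearMap.range ι.toLinearMap := hfam.domain_eq x ▸ φ.2
        obtain rfl : φ = ⟨ι w, hfam.mem_domain x w⟩ := Subtype.ext hw.symm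
        exact ⟨w, by rw [← hSD']; rfl⟩
      intro η
      have := hcl.closure_eq ▸ hdense η
      exact this
    obtain ⟨R, h1, h2, h3, h4⟩ := exists_continuous_inverse hT hC₁ hb hs
    exact ⟨R, h1, h2, h3, _, h4⟩

end IsWeaklyDifferentiableFamily

/-! ### Density of elementary sections and countable generation. -/

section Density

open Filter Topology Set

variable {m : ℕ} {M : Type*} [TopologicalSpace M] [T2Space M]
    [SecondCountableTopology M] [ChartedSpace (EuclideanSpace ℝ (Fin m)) M]
    [IsManifold (𝓡 m) ∞ M]

variable (m) in
/-- `C₀(M, V)` is the closure of any additive subgroup containing the functions `x ↦ f x • v`, for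
`f` smooth with compact support and `v` in a dense subset of `V`. -/
theorem dense_zeroAtInfty_of_smul_mem {V : Type*} [NormedAddCommGroup V] [NormedSpace ℝ V]
    {S : Set V} (hS : Dense S) (U : AddSubmonoid C₀(M, V))
    (hU : ∀ (f : M → ℝ) (v : V) (g : C₀(M, V)), ContMDiff (𝓡 m) 𝓘(ℝ, ℝ) ∞ f →
      HasCompactSupport f → v ∈ S → (∀ x, g x = f x • v) → g ∈ U) :
    Dense (U : Set C₀(M, V)) := by
  intro g
  refine Metric.mem_closure_iff.mpr fun ε hε => ?_
  obtain ⟨n, f, v, hf, hfc, -, hv, hfg⟩ := exists_smooth_sum_approx (m := m) S g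
    (map_continuous g) (zero_at_infty g) (fun x => hS (g x)) (half_pos hε)
  let h : Fin n → C₀(M, V) := fun i => c0OfCompactSupport (fun x => f i x • v i)
    ((hf i).continuous.smul continuous_const) (hfc i).smul_right
  refine ⟨∑ i, h i, sum_mem fun i _ => hU _ _ _ (hf i) (hfc i) (hv i) fun x => rfl, ?_⟩
  refine lt_of_le_of_lt ?_ (half_lt_self hε)
  rw [dist_eq_norm, C0Module.norm_le_iff _ (half_pos hε).le]
  intro x
  rw [ZeroAtInftyContinuousMap.sub_apply, c0_sum_apply]
  exact hfg x

theorem dense_tensorSmooth {A : Type*} [NonUnitalCStarAlgebra A]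
    {𝒜 : NonUnitalStarSubalgebra ℂ A} (h𝒜 : Dense (𝒜 : Set A)) :
    Dense (tensorSmooth m M 𝒜 : Set C₀(M, A)) := by
  refine dense_zeroAtInfty_of_smul_mem m h𝒜 (tensorSmooth m M 𝒜).toAddSubmonoid
    fun f v g hf hfc hv hg => ?_
  refine Submodule.subset_span ⟨v, hv, fun x => (f x : ℂ), ?_, ?_, fun x => ?_⟩
  · exact Complex.ofRealCLM.contDiff.contMDiff.comp hf
  · exact hfc.comp_left (g := Complex.ofReal) Complex.ofReal_zero
  · rw [hg]; simp

/-- `C₀(M, H)` is countably generated over `C₀(M)` for separable `H`. -/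
theorem isCountablyGeneratedModule_zeroAtInfty (m : ℕ) {M : Type*} [TopologicalSpace M] [T2Space M]
    [SecondCountableTopology M] [ChartedSpace (EuclideanSpace ℝ (Fin m)) M]
    [IsManifold (𝓡 m) ∞ M] {H : Type*} [NormedAddCommGroup H]
    [InnerProductSpace ℂ H] [SecondCountableTopology H] :
    IsCountablyGeneratedModule C₀(M, ℂ) C₀(M, H) := by
  have : LocallyCompactSpace M := ChartedSpace.locallyCompactSpace (EuclideanSpace ℝ (Fin m)) M
  have : TopologicalSpace.SeparableSpace C₀(M, H) := separableSpace_zeroAtInfty m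
  obtain ⟨s, hsc, hsd⟩ := TopologicalSpace.exists_countable_dense C₀(M, H)
  refine ⟨s, hsc, dense_iff_closure_eq.mpr (eq_univ_of_univ_subset ?_)⟩
  rw [← hsd.closure_eq]
  refine closure_minimal (fun e he => ?_) isClosed_closure
  refine Metric.mem_closure_iff.mpr fun ε hε => ?_
  -- Multiplying `e` by a cutoff equal to one where `e` is large changes it by little, so every `e`
  -- is a limit of elements `b • e`.
  obtain ⟨K, hK, hKs⟩ := mem_cocompact.mp
    ((zero_at_infty e) (Metric.closedBall_mem_nhds 0 (half_pos hε)))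
  obtain ⟨f, hfK, -, hfc, hf01⟩ := exists_continuous_one_zero_of_isCompact hK isClosed_empty
    (disjoint_empty K)
  let b : C₀(M, ℂ) := c0OfCompactSupport (fun x => (f x : ℂ))
    (Complex.continuous_ofReal.comp f.continuous)
    (hfc.comp_left (g := Complex.ofReal) Complex.ofReal_zero)
  refine ⟨b • e, Submodule.subset_span ⟨b, e, he, rfl⟩, lt_of_le_of_lt ?_ (half_lt_self hε)⟩
  rw [dist_eq_norm, C0Module.norm_le_iff _ (half_pos hε).le]
  intro x
  have h1 : (e - b • e) x = ((1 - f x : ℝ) : ℂ) • e x := by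
    rw [ZeroAtInftyContinuousMap.sub_apply, C0Module.smul_apply, Complex.ofReal_sub, sub_smul]
    simp [b, c0OfCompactSupport]
  rw [h1, norm_smul, Complex.norm_of_nonneg (sub_nonneg.mpr (hf01 x).2)]
  by_cases hx : x ∈ K
  · simpa [hfK hx] using (half_pos hε).le
  · have h2 : ‖e x‖ ≤ ε / 2 := by simpa using hKs hx
    exact (mul_le_of_le_one_left (norm_nonneg _) (by linarith [(hf01 x).1])).trans h2

theorem IsCountablyGeneratedModule.separableSpace {H : Type*} [NormedAddCommGroup H]
    [InnerProductSpace ℂ H] (h : IsCountablyGeneratedModule ℂ H) :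
    TopologicalSpace.SeparableSpace H := by
  obtain ⟨s, hs, hd⟩ := h
  have h1 : Submodule.span ℂ {y : H | ∃ b : ℂ, ∃ e ∈ s, y = b • e} ≤ Submodule.span ℂ s := by
    refine Submodule.span_le.mpr ?_
    rintro _ ⟨b, e, he, rfl⟩
    exact Submodule.smul_mem _ b (Submodule.subset_span he)
  rw [← TopologicalSpace.isSeparable_univ_iff, ← (hd.mono h1).closure_eq]
  exact (TopologicalSpace.IsSeparable.span hs.isSeparable).closure

end Density

/-! ### Constructing operators on the module of sections. -/

section Operator

/-- The unbounded operator `J v ↦ T v` with domain the range of an injective map `J`. -/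
noncomputable def LinearPMap.ofInjective {V E F : Type*} [AddCommGroup V] [Module ℂ V]
    [AddCommGroup E] [Module ℂ E] [AddCommGroup F] [Module ℂ F] (J : V →ₗ[ℂ] E)
    (hJ : Function.Injective J) (T : V →ₗ[ℂ] F) : E →ₗ.[ℂ] F :=
  ⟨LinearMap.range J, T ∘ₗ (LinearEquiv.ofInjective J hJ).symm⟩

theorem LinearPMap.ofInjective_apply {V E F : Type*} [AddCommGroup V] [Module ℂ V]
    [AddCommGroup E] [Module ℂ E] [AddCommGroup F] [Module ℂ F] {J : V →ₗ[ℂ] E}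
    (hJ : Function.Injective J) (T : V →ₗ[ℂ] F) (v : V) (h : J v ∈ (ofInjective J hJ T).domain) :
    ofInjective J hJ T ⟨J v, h⟩ = T v :=
  congrArg T ((LinearEquiv.ofInjective J hJ).symm_apply_apply v)

variable {M : Type*} [TopologicalSpace M] {H : Type*} [NormedAddCommGroup H]
  [InnerProductSpace ℂ H]

/-- A bounded norm continuous family of operators on `H` defines an adjointable operator. -/
theorem isAdjointableEnd_c0Map [CompleteSpace H] {T : M → H →L[ℂ] H} (hT : Continuous T) {C : ℝ}
    (hC : ∀ x, ‖T x‖ ≤ C) :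
    IsAdjointableEnd C₀(M, ℂ) (c0Map T (fun _ => hT.clm_apply continuous_const) C hC) := by
  have hT' : Continuous fun x => (T x).adjoint :=
    ContinuousLinearMap.adjoint.continuous.comp hT
  refine ⟨c0Map (fun x => (T x).adjoint) (fun _ => hT'.clm_apply continuous_const) C
    (fun x => by simpa using hC x), fun φ ψ => ZeroAtInftyContinuousMap.ext fun x => ?_⟩
  exact ((T x).adjoint_inner_right _ _).symm

theorem isCompactFromDomain_of_fintype {B E : Type*} [NonUnitalCommCStarAlgebra B]
    [PartialOrder B] [NormedAddCommGroup E] [NormedSpace ℂ E]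
    [SMul B E] [CStarModule B E] {D : E →ₗ.[ℂ] E} {T : E →L[ℂ] E}
    (h : ∀ ε : ℝ, 0 < ε → ∃ (n : ℕ) (k : Fin n → ℕ) (x : ∀ i, Fin (k i) → E)
      (y : ∀ i, Fin (k i) → D.domain), ∀ ψ : D.domain,
      ‖T ψ - ∑ i, ∑ j, graphInner B D (y i j) ψ • x i j‖ ≤ ε * graphNorm B D ψ) :
    IsCompactFromDomain B D T := by
  intro ε hε
  obtain ⟨n, k, x, y, hxy⟩ := h ε hε
  let e := Fintype.equivFin (Σ i, Fin (k i))
  refine ⟨_, fun l => x (e.symm l).1 (e.symm l).2, fun l => y (e.symm l).1 (e.symm l).2,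
    fun ψ => ?_⟩
  rw [e.symm.sum_comp fun l : Σ i, Fin (k i) => graphInner B D (y l.1 l.2) ψ • x l.1 l.2,
    Fintype.sum_sigma]
  exact hxy ψ

end Operator

/-! ### The representation on sections, local compactness and commutators. -/

namespace IsWeaklyDifferentiableFamily

open Filter Topology

variable {m : ℕ} {M : Type*} [TopologicalSpace M]
    [ChartedSpace (EuclideanSpace ℝ (Fin m)) M]
    [IsManifold (𝓡 m) ∞ M] [Bundle.RiemannianBundle (fun x : M => TangentSpace (𝓡 m) x)]
    [IsContMDiffRiemannianBundle (𝓡 m) ∞ (EuclideanSpace ℝ (Fin m))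
      (fun x : M => TangentSpace (𝓡 m) x)]
    {A : Type*} [NonUnitalCStarAlgebra A] {𝒜 : NonUnitalStarSubalgebra ℂ A}
    {H : Type*} [NormedAddCommGroup H] [InnerProductSpace ℂ H] [CompleteSpace H]
    {W : Type*} [NormedAddCommGroup W] [InnerProductSpace ℂ W]
    {ρ : M → A →ₙₐ[ℂ] (H →L[ℂ] H)} {D : M → H →ₗ.[ℂ] H} {ι : W →L[ℂ] H}

/-- The representation of `C₀(M, A)` on `C₀(M, H)`. -/
noncomputable def rep (hfam : IsWeaklyDifferentiableFamily m 𝒜 ρ D ι) :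
    C₀(M, A) →ₙₐ[ℂ] (C₀(M, H) →L[ℂ] C₀(M, H)) where
  toFun a := c0Map (fun x => ρ x (a x))
    (fun _ => (hfam.continuous_rep_apply (map_continuous a)).clm_apply continuous_const) ‖a‖
    (fun x => (hfam.norm_rep_le x _).trans (c0_norm_apply_le a x))
  map_smul' c a := by
    ext ψ x
    change ρ x (c • a x) (ψ x) = c • ρ x (a x) (ψ x)
    rw [map_smul]; rfl
  map_zero' := by
    ext ψ x
    change ρ x 0 (ψ x) = 0
    rw [map_zero]; rfl
  map_add' a b := by
    ext ψ x
    change ρ x (a x + b x) (ψ x) = ρ x (a x) (ψ x) + ρ x (b x) (ψ x)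
    rw [map_add]; rfl
  map_mul' a b := by
    ext ψ x
    change ρ x (a x * b x) (ψ x) = ρ x (a x) (ρ x (b x) (ψ x))
    rw [map_mul]; rfl

theorem rep_apply (hfam : IsWeaklyDifferentiableFamily m 𝒜 ρ D ι) (a : C₀(M, A)) (ψ : C₀(M, H))
    (x : M) : hfam.rep a ψ x = ρ x (a x) (ψ x) := rfl

-- Compact operators form a norm closed set and `a ↦ ρ x a ∘L ι` is continuous, so the condition on
-- the dense `𝒜` passes to `A`.
omit [IsManifold (𝓡 m) ∞ M] [IsContMDiffRiemannianBundle (𝓡 m) ∞ (EuclideanSpace ℝ (Fin m))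
      (fun x : M => TangentSpace (𝓡 m) x)] in
theorem isCompactOperator_rep_comp (hfam : IsWeaklyDifferentiableFamily m 𝒜 ρ D ι) (x : M)
    (a : A) : IsCompactOperator (ρ x a ∘L ι) := by
  let L : A →L[ℂ] (W →L[ℂ] H) := (ContinuousLinearMap.precomp H ι) ∘L
    (LinearMap.mkContinuous { ρ x with } 1 fun a => by simpa using hfam.norm_rep_le x a)
  have hcl : IsClosed {a | IsCompactOperator (L a)} :=
    isClosed_setOfPred_isCompactOperator.preimage L.continuous
  have hsub : closure (𝒜 : Set A) ⊆ {a | IsCompactOperator (L a)} :=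
    closure_minimal (fun a ha => hfam.embedding_locallyCompact x a ha) hcl
  exact hsub ((hfam.spectralTriple x).dense a)

section Commutator

variable {S : M → W →L[ℂ] H} {R : M → H →L[ℂ] W} {c : ℂ}

/-- Elements of `𝒜 ⊙ C_c^∞(M)` preserve `C₀(M, W)`, with bounded commutators. -/
theorem exists_commutator (hfam : IsWeaklyDifferentiableFamily m 𝒜 ρ D ι)
    (hSc : Continuous S) (hSD : ∀ x w, S x w = D x ⟨ι w, hfam.mem_domain x w⟩)
    (hRS : ∀ x w, R x (S x w + c • ι w) = w) (hRc : Continuous R)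
    {g : C₀(M, A)} (hg : g ∈ tensorSmooth m M 𝒜) :
    ∃ T : M → H →L[ℂ] H, Continuous T ∧ (∃ C, ∀ x, ‖T x‖ ≤ C) ∧
      ∀ φ : C₀(M, W), ∃ φ' : C₀(M, W), ∀ x, ι (φ' x) = ρ x (g x) (ι (φ x)) ∧
        T x (ι (φ x)) = S x (φ' x) - ρ x (g x) (S x (φ x)) := by
  replace hg : g ∈ Submodule.span ℂ {g : C₀(M, A) | ∃ a ∈ 𝒜, ∃ f : M → ℂ,
    ContMDiff (𝓡 m) 𝓘(ℝ, ℂ) ∞ f ∧ HasCompactSupport f ∧ ∀ x, g x = f x • a} := hg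
  induction hg using Submodule.span_induction with
  | mem g hg =>
    obtain ⟨a, ha, f, hf, hfc, hgf⟩ := hg
    obtain ⟨T, hTc, hT⟩ := hfam.continuous_commutator a ha
    have hfT : Continuous fun x => f x • T x := hf.continuous.smul hTc
    refine ⟨fun x => f x • T x, hfT,
      hfT.bounded_above_of_compact_support hfc.smul_right, fun φ => ?_⟩
    -- This is `(D x + c)` applied to `ρ x a (ι (φ x))`, rewritten through the commutator so that it
    -- is visibly continuous in `x`. Applying `R` then gives continuity of `ρ x a (ι (φ x))` in the
    -- norm of `W`.
    let η : M → H := fun x =>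
      T x (ι (φ x)) + ρ x a (S x (φ x)) + c • ρ x a (ι (φ x))
    have hφ := map_continuous φ
    have hρ := hfam.continuous_rep a
    have hη : Continuous η :=
      ((hTc.clm_apply (ι.continuous.comp hφ)).add (hρ.clm_apply (hSc.clm_apply hφ))).add
        ((hρ.clm_apply (ι.continuous.comp hφ)).const_smul c)
    have key : ∀ x, ι (R x (η x)) = ρ x a (ι (φ x)) ∧
        T x (ι (φ x)) = S x (R x (η x)) - ρ x a (S x (φ x)) := fun x => by
      have hmem := (hfam.spectralTriple x).map_domain a ha _ (hfam.mem_domain x (φ x))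
      obtain ⟨w, hw⟩ : ρ x a (ι (φ x)) ∈ LinearMap.range ι.toLinearMap := hfam.domain_eq x ▸ hmem
      replace hw : ι w = ρ x a (ι (φ x)) := hw
      have h1 : T x (ι (φ x)) = S x w - ρ x a (S x (φ x)) := by
        rw [hSD, hSD, hT x ⟨ι (φ x), hfam.mem_domain x _⟩ hmem]
        simp only [hw]
      have h2 : R x (η x) = w := by
        rw [← hRS x w]
        simp only [η, h1, hw]
        congr 1
        abel
      rw [h2]
      exact ⟨hw, h1⟩
    refine ⟨c0OfCompactSupport (fun x => f x • R x (η x))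
      (hf.continuous.smul (hRc.clm_apply hη)) hfc.smul_right, fun x => ?_⟩
    change ι (f x • R x (η x)) = _ ∧ f x • T x (ι (φ x)) = S x (f x • R x (η x)) - _
    rw [hgf, map_smul, map_smul, map_smul, (key x).1, (key x).2, smul_sub]
    exact ⟨rfl, rfl⟩
  | zero =>
    refine ⟨0, continuous_zero, ⟨0, by simp⟩, fun φ => ⟨0, fun x => ?_⟩⟩
    simp
  | add g₁ g₂ _ _ h₁ h₂ =>
    obtain ⟨T₁, hT₁, ⟨C₁, hC₁⟩, h₁⟩ := h₁
    obtain ⟨T₂, hT₂, ⟨C₂, hC₂⟩, h₂⟩ := h₂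
    refine ⟨T₁ + T₂, hT₁.add hT₂, ⟨C₁ + C₂, fun x => norm_add_le_of_le (hC₁ x) (hC₂ x)⟩,
      fun φ => ?_⟩
    obtain ⟨φ₁, h₁⟩ := h₁ φ
    obtain ⟨φ₂, h₂⟩ := h₂ φ
    refine ⟨φ₁ + φ₂, fun x => ?_⟩
    simp only [ZeroAtInftyContinuousMap.add_apply, Pi.add_apply, map_add, add_apply, (h₁ x).1,
      (h₂ x).1, (h₁ x).2, (h₂ x).2, true_and]
    abel
  | smul z g _ h =>
    obtain ⟨T, hT, ⟨C, hC⟩, h⟩ := h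
    refine ⟨z • T, hT.const_smul z, ⟨‖z‖ * C, fun x => ?_⟩, fun φ => ?_⟩
    · rw [Pi.smul_apply, norm_smul]
      exact mul_le_mul_of_nonneg_left (hC x) (norm_nonneg z)
    · obtain ⟨φ', h⟩ := h φ
      refine ⟨z • φ', fun x => ?_⟩
      simp only [ZeroAtInftyContinuousMap.smul_apply, Pi.smul_apply, map_smul, smul_apply,
        (h x).1, (h x).2, smul_sub, true_and]

end Commutator

end IsWeaklyDifferentiableFamily

/-! ### Assembly of the Kasparov module. -/

theorem mainTheorem9 {m : ℕ} {M : Type*} [TopologicalSpace M] [T2Space M]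
    [SecondCountableTopology M] [ChartedSpace (EuclideanSpace ℝ (Fin m)) M]
    [IsManifold (𝓡 m) ∞ M] [Bundle.RiemannianBundle (fun x : M => TangentSpace (𝓡 m) x)]
    [IsContMDiffRiemannianBundle (𝓡 m) ∞ (EuclideanSpace ℝ (Fin m))
      (fun x : M => TangentSpace (𝓡 m) x)]
    {A : Type*} [NonUnitalCStarAlgebra A] (𝒜 : NonUnitalStarSubalgebra ℂ A)
    {H : Type*} [NormedAddCommGroup H] [InnerProductSpace ℂ H] [CompleteSpace H]
    {W : Type*} [NormedAddCommGroup W] [InnerProductSpace ℂ W] [CompleteSpace W]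
    (ρ : M → A →ₙₐ[ℂ] (H →L[ℂ] H)) (D : M → H →ₗ.[ℂ] H) (ι : W →L[ℂ] H)
    (hfam : IsWeaklyDifferentiableFamily m 𝒜 ρ D ι) :
    ∃ (ρM : C₀(M, A) →ₙₐ[ℂ] (C₀(M, H) →L[ℂ] C₀(M, H))) (DM : C₀(M, H) →ₗ.[ℂ] C₀(M, H)),
      -- the pointwise representation of `C₀(M, A)`
      (∀ (a : C₀(M, A)) (ψ : C₀(M, H)) (x : M), ρM a ψ x = ρ x (a x) (ψ x)) ∧
      -- the pointwise operator, whose domain is `C₀(M, W)`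
      (∀ ψ : C₀(M, H), ψ ∈ DM.domain ↔ ∃ φ : C₀(M, W), ∀ x, ι (φ x) = ψ x) ∧
      (∀ (ψ : DM.domain) (x : M), ∃ h : (ψ : C₀(M, H)) x ∈ (D x).domain,
        DM ψ x = D x ⟨(ψ : C₀(M, H)) x, h⟩) ∧
      IsOddUnboundedKasparovModule C₀(M, ℂ) (tensorSmooth m M 𝒜) ρM DM := by
  obtain ⟨S, hSc, ⟨CS, hCS⟩, hSD, hsymm, hR⟩ := hfam.exists_op
  obtain ⟨R, hTR, hRT, hRc, CR, hCR⟩ := hR Complex.I (by simp) Complex.I_mul_I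
  obtain ⟨R', hTR', -, hRc', CR', hCR'⟩ := hR (-Complex.I) (by simp) (by simp)
  let J : C₀(M, W) →L[ℂ] C₀(M, H) :=
    c0Map (fun _ => ι) (fun _ => continuous_const) ‖ι‖ (fun _ => le_rfl)
  let SM : C₀(M, W) →L[ℂ] C₀(M, H) :=
    c0Map S (fun _ => hSc.clm_apply continuous_const) CS hCS
  have hJ : Function.Injective J.toLinearMap := fun φ ψ h =>
    ZeroAtInftyContinuousMap.ext fun x => hfam.embedding_injective (DFunLike.congr_fun h x)
  let DM : C₀(M, H) →ₗ.[ℂ] C₀(M, H) := LinearPMap.ofInjective J.toLinearMap hJ SM.toLinearMap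
  let j : C₀(M, W) → DM.domain := fun φ => ⟨J φ, φ, rfl⟩
  have hj : ∀ ψ : DM.domain, ∃ φ, ψ = j φ := by
    rintro ⟨_, φ, rfl⟩; exact ⟨φ, rfl⟩
  have hDj : ∀ φ, DM (j φ) = SM φ := fun φ =>
    LinearPMap.ofInjective_apply hJ SM.toLinearMap φ (j φ).2
  have hdom : ∀ ψ : C₀(M, H), ψ ∈ DM.domain ↔ ∃ φ : C₀(M, W), ∀ x, ι (φ x) = ψ x := fun ψ =>
    ⟨fun ⟨φ, h⟩ => ⟨φ, fun x => DFunLike.congr_fun h x⟩,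
      fun ⟨φ, h⟩ => ⟨φ, ZeroAtInftyContinuousMap.ext h⟩⟩
  have hdense : Dense (DM.domain : Set C₀(M, H)) := by
    refine dense_zeroAtInfty_of_smul_mem m hfam.embedding_denseRange DM.domain.toAddSubmonoid ?_
    rintro f _ g hf hfc ⟨w, rfl⟩ hg
    refine (hdom g).mpr ⟨c0OfCompactSupport (fun x => f x • w)
      (hf.continuous.smul continuous_const) hfc.smul_right, fun x => ?_⟩
    change ι (f x • w) = g x
    rw [hg, ← Complex.coe_smul, map_smul, Complex.coe_smul]
  have hplus : ∀ η : C₀(M, H), ∃ φ : DM.domain, DM φ + Complex.I • (φ : C₀(M, H)) = η :=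
    fun η => ⟨j (c0Map R (fun _ => hRc.clm_apply continuous_const) CR hCR η), by
      rw [hDj]; exact ZeroAtInftyContinuousMap.ext fun x => hTR x (η x)⟩
  have hminus : ∀ η : C₀(M, H), ∃ φ : DM.domain, DM φ - Complex.I • (φ : C₀(M, H)) = η :=
    fun η => ⟨j (c0Map R' (fun _ => hRc'.clm_apply continuous_const) CR' hCR' η), by
      rw [hDj, sub_eq_add_neg, ← neg_smul]
      exact ZeroAtInftyContinuousMap.ext fun x => hTR' x (η x)⟩
  have hself : IsSelfAdjointOp C₀(M, ℂ) DM := by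
    refine isSelfAdjointOp_of_surjective DM hdense (fun φ ψ => ?_) hplus hminus
    obtain ⟨φ, rfl⟩ := hj φ
    obtain ⟨ψ, rfl⟩ := hj ψ
    rw [hDj, hDj]
    exact ZeroAtInftyContinuousMap.ext fun x => hsymm x (φ x) (ψ x)
  have hcomm := fun {g : C₀(M, A)} (hg : g ∈ tensorSmooth m M 𝒜) =>
    hfam.exists_commutator hSc hSD hRT hRc hg
  have hmap : ∀ g ∈ tensorSmooth m M 𝒜, ∀ ψ ∈ DM.domain, hfam.rep g ψ ∈ DM.domain := by
    rintro g hg _ ⟨φ, rfl⟩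
    obtain ⟨T, -, -, hT⟩ := hcomm hg
    obtain ⟨φ', h⟩ := hT φ
    exact (hdom _).mpr ⟨φ', fun x => (h x).1⟩
  have hsep : TopologicalSpace.IsSeparable (tensorSmooth m M 𝒜 : Set C₀(M, A)) ∧
      IsCountablyGeneratedModule C₀(M, ℂ) C₀(M, H) ∧
      Dense (tensorSmooth m M 𝒜 : Set C₀(M, A)) := by
    -- Separability of `A` and `H` is read off from one fibre; without fibres the section spaces are
    -- trivial.
    rcases isEmpty_or_nonempty M with hM | ⟨⟨x₀⟩⟩
    · have : Subsingleton C₀(M, A) := ⟨ZeroAtInftyContinuousMap.eq_of_empty⟩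
      have : Subsingleton C₀(M, H) := ⟨ZeroAtInftyContinuousMap.eq_of_empty⟩
      refine ⟨(Set.subsingleton_of_subsingleton.countable).isSeparable,
        ⟨∅, Set.countable_empty, fun ψ => ?_⟩, fun a => ?_⟩
      · rw [Subsingleton.elim ψ 0]; exact subset_closure (zero_mem _)
      · rw [Subsingleton.elim a 0]; exact subset_closure (zero_mem (tensorSmooth m M 𝒜))
    · have h₀ := hfam.spectralTriple x₀
      have := h₀.countablyGenerated.separableSpace
      have : SecondCountableTopology H := UniformSpace.secondCountable_of_separable H
      have : TopologicalSpace.SeparableSpace A := by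
        rw [← TopologicalSpace.isSeparable_univ_iff, ← h₀.dense.closure_eq]
        exact h₀.separable.closure
      have : SecondCountableTopology A := UniformSpace.secondCountable_of_separable A
      have : TopologicalSpace.SeparableSpace C₀(M, A) := separableSpace_zeroAtInfty m
      exact ⟨.of_separableSpace _, isCountablyGeneratedModule_zeroAtInfty m,
        dense_tensorSmooth h₀.dense⟩
  refine ⟨hfam.rep, DM, hfam.rep_apply, hdom, fun ψ x => ?_, ?_⟩
  · obtain ⟨φ, rfl⟩ := hj ψ
    refine ⟨hfam.mem_domain x (φ x), ?_⟩
    rw [hDj]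
    exact hSD x (φ x)
  refine
    { countablyGenerated := hsep.2.1
      star_hom := fun a φ ψ => ZeroAtInftyContinuousMap.ext fun x =>
        (hfam.spectralTriple x).star_hom (a x) (φ x) (ψ x)
      separable := hsep.1
      dense := hsep.2.2
      moduleLinear := fun b ψ => ?_
      selfAdjoint := hself
      regular := hself.isRegularOp DM hplus hminus
      map_domain := hmap
      bounded_commutator := fun g hg => ?_
      locally_compact := fun a => isCompactFromDomain_of_fintype fun ε hε => ?_ }
  · obtain ⟨φ, rfl⟩ := hj ψ
    have h : b • (j φ : C₀(M, H)) = j (b • φ) :=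
      ZeroAtInftyContinuousMap.ext fun x => (ι.map_smul (b x) (φ x)).symm
    refine ⟨h ▸ (j (b • φ)).2, ?_⟩
    have h' : DM ⟨b • (j φ : C₀(M, H)), h ▸ (j (b • φ)).2⟩ = DM (j (b • φ)) :=
      congrArg DM (Subtype.ext h)
    rw [h', hDj, hDj]
    exact ZeroAtInftyContinuousMap.ext fun x => (S x).map_smul (b x) (φ x)
  · obtain ⟨T, hTc, ⟨C, hC⟩, hT⟩ := hcomm hg
    refine ⟨_, isAdjointableEnd_c0Map hTc hC, fun ψ => ?_⟩
    obtain ⟨φ, rfl⟩ := hj ψ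
    obtain ⟨φ', h⟩ := hT φ
    have h' : DM ⟨hfam.rep g (j φ), hmap g hg _ (j φ).2⟩ = DM (j φ') :=
      congrArg DM (Subtype.ext (ZeroAtInftyContinuousMap.ext fun x => (h x).1.symm))
    rw [h', hDj, hDj]
    exact ZeroAtInftyContinuousMap.ext fun x => (h x).2
  -- On `Dom D` the operator `ρ(a)` is `G` composed with `D + i`, so approximating `G` in norm
  -- approximates `ρ(a)` relative to the graph norm.
  · let G : M → H →L[ℂ] H := fun x => (ρ x (a x) ∘L ι) ∘L R x
    have hGc : Continuous G :=
      ((hfam.continuous_rep_apply (map_continuous a)).clm_comp continuous_const).clm_comp hRc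
    have hG0 : Filter.Tendsto G (Filter.cocompact M) (nhds 0) := by
      refine squeeze_zero_norm (a := fun x => ‖a x‖ * ‖ι‖ * CR) (fun x => ?_) ?_
      · refine (ContinuousLinearMap.opNorm_comp_le _ _).trans ?_
        refine mul_le_mul ((ContinuousLinearMap.opNorm_comp_le _ _).trans ?_) (hCR x)
          (norm_nonneg _) (by positivity)
        exact mul_le_mul_of_nonneg_right (hfam.norm_rep_le x _) (norm_nonneg _)
      · simpa using ((zero_at_infty a).norm.mul_const ‖ι‖).mul_const CR
    have hGK : ∀ x, G x ∈ closure (finiteRankOps H) := fun x =>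
      ((hfam.isCompactOperator_rep_comp x (a x)).comp_clm (R x)).mem_closure_finiteRankOps
    obtain ⟨n, f, F, hf, hfc, hf0, hF, hGF⟩ :=
      exists_smooth_sum_approx (m := m) (finiteRankOps H) G hGc hG0 hGK hε
    choose N k h hFk using hF
    -- Each weight `f i ≥ 0` is split as a product of square roots, so that both vectors of a rank
    -- one operator are compactly supported sections. Taking `Y = √f • R k` gives `(D + i) Y = √f •
    -- k`.
    have hsc : ∀ i, Continuous fun x => Real.sqrt (f i x) := fun i =>
      Real.continuous_sqrt.comp (hf i).continuous
    have hsk : ∀ i, HasCompactSupport fun x => Real.sqrt (f i x) := fun i =>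
      (hfc i).comp_left Real.sqrt_zero
    let X : ∀ i, Fin (N i) → C₀(M, H) := fun i l =>
      c0OfCompactSupport (fun x => Real.sqrt (f i x) • h i l)
        ((hsc i).smul continuous_const) (hsk i).smul_right
    let Y : ∀ i, Fin (N i) → C₀(M, W) := fun i l =>
      c0OfCompactSupport (fun x => Real.sqrt (f i x) • R x (k i l))
        ((hsc i).smul (hRc.clm_apply continuous_const)) (hsk i).smul_right
    refine ⟨n, N, X, fun i l => j (Y i l), fun ψ => ?_⟩
    obtain ⟨φ, rfl⟩ := hj ψ
    -- The cross terms cancel by symmetry of `S x`, so `D + i` preserves inner products from the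
    -- graph module to `C₀(M, H)`.
    have hinner : ∀ (φ₁ φ₂ : C₀(M, W)) (x : M),
        graphInner C₀(M, ℂ) DM (j φ₁) (j φ₂) x =
          inner ℂ (S x (φ₁ x) + Complex.I • ι (φ₁ x)) (S x (φ₂ x) + Complex.I • ι (φ₂ x)) := by
      intro φ₁ φ₂ x
      rw [graphInner, hDj, hDj]
      change inner ℂ (ι (φ₁ x)) (ι (φ₂ x)) + inner ℂ (S x (φ₁ x)) (S x (φ₂ x)) = _
      rw [inner_add_left, inner_add_right, inner_add_right, inner_smul_left, inner_smul_left,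
        inner_smul_right, inner_smul_right, Complex.conj_I, hsymm x (φ₁ x) (φ₂ x)]
      linear_combination (inner ℂ (ι (φ₁ x)) (ι (φ₂ x))) * Complex.I_mul_I
    have hnorm : ∀ x, ‖S x (φ x) + Complex.I • ι (φ x)‖ ≤ graphNorm C₀(M, ℂ) DM (j φ) := by
      intro x
      refine Real.le_sqrt_of_sq_le (le_trans (le_of_eq ?_)
        (c0_norm_apply_le (graphInner C₀(M, ℂ) DM (j φ) (j φ)) x))
      rw [hinner, inner_self_eq_norm_sq_to_K]
      simp
    refine (C0Module.norm_le_iff _ (mul_nonneg hε.le (Real.sqrt_nonneg _))).mpr fun x => ?_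
    set u : H := S x (φ x) + Complex.I • ι (φ x)
    have h1 : hfam.rep a (j φ) x = G x u := by
      change _ = ρ x (a x) (ι (R x u))
      rw [hRT]; rfl
    have h2 : (∑ i, ∑ l, graphInner C₀(M, ℂ) DM (j (Y i l)) (j φ) • X i l) x =
        (∑ i, f i x • F i) u := by
      rw [c0_sum_apply, sum_apply]
      refine Finset.sum_congr rfl fun i _ => ?_
      rw [c0_sum_apply, smul_apply, hFk, Finset.smul_sum]
      refine Finset.sum_congr rfl fun l _ => ?_
      rw [C0Module.smul_apply, hinner]
      change inner ℂ (S x (Real.sqrt (f i x) • R x (k i l)) +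
        Complex.I • ι (Real.sqrt (f i x) • R x (k i l))) u • (Real.sqrt (f i x) • h i l) = _
      rw [← Complex.coe_smul, map_smul, map_smul, smul_comm Complex.I, ← smul_add, hTR,
        inner_smul_left, Complex.conj_ofReal, ← Complex.coe_smul, ← Complex.coe_smul, smul_smul,
        smul_smul]
      congr 1
      have : ((f i x : ℝ) : ℂ) = Real.sqrt (f i x) * Real.sqrt (f i x) := by
        rw [← Complex.ofReal_mul, Real.mul_self_sqrt (hf0 i x)]
      rw [this]
      ring
    rw [ZeroAtInftyContinuousMap.sub_apply, h1, h2, ← sub_apply]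
    exact (ContinuousLinearMap.le_of_opNorm_le _ (hGF x) u).trans
      (mul_le_mul_of_nonneg_left (hnorm x) hε.le)
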